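/- Let $\lambda$ be a regular infinite cardinal and $\mathcal C$ a locally $\lambda$-presentable category. A morphism $f\colon A\to B$ is called $\lambda$-presentable if it is a $\lambda$-presentable object of the comma category $(A\downarrow\mathcal C)$. Let $\mathcal M=\lambda\text{-Mor}$ be the class of all $\lambda$-presentable morphisms, $\mathcal M^{\triangle}$ the class of objects injective with respect to all members of $\mathcal M$, $\mathcal M^{\triangle\triangledown}$ the class of morphisms with respect to which all objects of $\mathcal M^{\triangle}$ are injective, and $\mathcal N=\lambda\text{-}(\mathcal M^{\triangle\triangledown})$ the class of $\lambda$-presentable morphisms in $\mathcal M^{\triangle\triangledown}$. Write $\mathrm{Ch}(\mathcal N)$ for the class of transfinite compositions of members of $\mathcal N$, $\mathrm{ReCh}(\mathcal N)$ for the class of retracts, in the categories $(A\downarrow\mathcal C)$, of members of $\mathrm{Ch}(\mathcal N)$ with domain $A$, and $\mathcal N^{\square}$ for the class of morphisms with the right lifting property with respect to $\mathcal N$. A morphism $f\colon A\to B$ is $\lambda$-pure if, whenever $fs=tz$ with $z\colon X\to Y$ a morphism between $\lambda$-presentable objects, there is $d\colon Y\to A$ with $dz=s$. For a regular cardinal $\gamma\ge\lambda$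 and $f\colon A\to B$, a strict (resp. loose) $\gamma$-factorization $f=f_\gamma f^*$ is obtained as follows. Put $A_0=A$, $f_0=f$. Given $f_\alpha\colon A_\alpha\to B$ with $\alpha<\gamma$, let $A_{\alpha+1}$ be the multiple pushout of a family of morphisms $h_i\colon A_\alpha\to X_i$, and let $f_{\alpha+1}\colon A_{\alpha+1}\to B$ be induced by morphisms $q_i\colon X_i\to B$ with $q_ih_i=f_\alpha$, where: in the strict case, $(h_i,q_i)_i$ is a skeleton of the category of all factorizations $f_\alpha=qh$ with $h$ a $\gamma$-presentable morphism; in the loose case, $(h_i)_i$ contains exactly one representative of each isomorphism class in $(A_\alpha\downarrow\mathcal C)$ of the $\gamma$-presentable morphisms through which $f_\alpha$ factors, and one $q_i$ is chosen for each $h_i$. At limit ordinals take colimits of chains; $f^*\colon A\to A_\gamma$ is the canonical morphism to the colimit $A_\gamma$ of the chain $(A_\alpha)_{\alpha<\gamma}$, and $f_\gamma\colon A_\gamma\to B$ is the induced morphism. Then: 1. $\mathcal N=\mathcal M$, and $\mathcal M^{\triangle}$ consists exactly of the terminal objects of $\mathcal C$. 2. $(\mathrm{ReCh}(\mathcal N),\mathcal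 N^{\square})$ is a functorial weak factorization system, and it is the trivial one: $\mathrm{ReCh}(\mathcal N)$ is the class of all morphisms and $\mathcal N^{\square}$ is the class of all isomorphisms. 3. Every morphism of $\mathcal C$ is a transfinite composition of $\lambda$-presentable morphisms. 4. Every morphism $f$ has a strict $\lambda$-factorization, and for each such factorization $f^*\in\mathrm{Ch}(\mathcal M)$, $f_\lambda\in\mathcal M^{\square}$, and $f_\lambda$ is an isomorphism. 5. A morphism $f$ is $\lambda$-pure if and only if, whenever $fs=tz$ with $z$ a $\lambda$-presentable morphism, there is $d$ with $dz=s$; and every $\lambda$-pure morphism is a monomorphism. 6. Every morphism $f$ has a loose $\lambda$-factorization, and for each such factorization $f^*\in\mathrm{Ch}(\mathcal M)$ and $f_\lambda$ is a $\lambda$-pure monomorphism. 7. There is a regular cardinal $\gamma\ge\lambda$, depending only on $\mathcal C$ and $\lambda$, such that every morphism has a loose $\gamma$-factorization and such that, for every regular cardinal $\beta>(\gamma^{<\gamma})^+$ with $\gamma$ sharply smaller than $\beta$ ($\gamma\triangleleft\beta$), every morphism $f\colon A\to B$ with $A$ $\beta$-presentable, and every loose $\gamma$-factorization $f=f_\gamma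 f^*$ of it, the object $A_\gamma$ is $\beta$-presentable and $f_\gamma$ is a $\gamma$-pure, hence $\lambda$-pure, monomorphism. 8. There are sufficiently many $\lambda$-pure subobjects: there are arbitrarily large regular cardinals $\beta$ such that every morphism $f\colon A\to B$ with $A$ $\beta$-presentable factorizes as $A\to A'\to B$ with $A'$ $\beta$-presentable and $A'\to B$ a $\lambda$-pure monomorphism. -/

import Mathlib

universe w v u

open CategoryTheory Limits

namespace PresentableMorphisms

section

variable {C : Type u} [Category.{v} C]

/-- A morphism `f : A ⟶ B` is `κ`-presentable if it is a `κ`-presentable object of the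
comma category `A ↓ C`. This is the class `κ-Mor` of all `κ`-presentable morphisms. -/
def presentableMor (C : Type u) [Category.{v} C] (κ : Cardinal.{w}) [Fact κ.IsRegular] :
    MorphismProperty C :=
  fun _ _ f => IsCardinalPresentable (Under.mk f) κ

/-- The objects injective with respect to all morphisms of the class `W`. -/
def injectives (W : MorphismProperty C) : ObjectProperty C :=
  fun K => ∀ ⦃A B : C⦄ (n : A ⟶ B), W n → ∀ u : A ⟶ K, ∃ g : B ⟶ K, n ≫ g = u

/-- The morphisms with respect to which all objects of the class `P` are injective. -/
def injectiveMor (P : ObjectProperty C) : MorphismProperty C :=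
  fun A B n => ∀ K : C, P K → ∀ u : A ⟶ K, ∃ g : B ⟶ K, n ≫ g = u

/-- The `κ`-presentable morphisms with respect to which every `M`-injective object is
injective. -/
def presentableClosure (κ : Cardinal.{w}) [Fact κ.IsRegular] (M : MorphismProperty C) :
    MorphismProperty C :=
  presentableMor C κ ⊓ injectiveMor (injectives M)

/-- `Re(W)`: the morphisms `f : A ⟶ B` that are retracts, in the comma category `A ↓ C`, of
a member of `W` with domain `A`. -/
def underRetracts (W : MorphismProperty C) : MorphismProperty C :=
  fun A _ f => ∃ (Y : C) (g : A ⟶ Y), W g ∧ Nonempty (Retract (Under.mk f) (Under.mk g))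

/-- `κ`-pure morphisms: in every commutative square `s ≫ f = z ≫ t` where `z : X ⟶ Y` is a
morphism between `κ`-presentable objects, the morphism `s` factors through `z`. -/
def IsPure (κ : Cardinal.{w}) [Fact κ.IsRegular] {A B : C} (f : A ⟶ B) : Prop :=
  ∀ ⦃X Y : C⦄, IsCardinalPresentable X κ → IsCardinalPresentable Y κ →
    ∀ (z : X ⟶ Y) (s : X ⟶ A) (t : Y ⟶ B), s ≫ f = z ≫ t → ∃ d : Y ⟶ A, z ≫ d = s

/-- `X'`, with `g : X ⟶ X'`, is the multiple pushout of the family `h i : X ⟶ Y i`, and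
`p' : X' ⟶ B` is the morphism induced by the morphisms `q i : Y i ⟶ B`. -/
def IsInducedMultiplePushout {B X X' : C} (g : X ⟶ X') (p' : X' ⟶ B) {ι : Type w}
    (Y : ι → C) (h : ∀ i, X ⟶ Y i) (q : ∀ i, Y i ⟶ B) : Prop :=
  ∃ (j : ∀ i, Y i ⟶ X') (hj : ∀ i, h i ≫ j i = g),
    Nonempty (IsColimit
      (WidePushoutShape.mkCocone (F := WidePushoutShape.wideSpan X Y h) g j hj)) ∧
    ∀ i, j i ≫ p' = q i

/-- One step of the strict construction over `B`, from `p : X ⟶ B` to `p' : X' ⟶ B`: the family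
`(h i, q i)` runs through a skeleton of the category of all factorizations `p = h ≫ q` of `p`
with `h` in `N`, and `X'` is the multiple pushout of the morphisms `h i`. -/
def IsStrictStep (N : MorphismProperty C) {B X X' : C} (p : X ⟶ B) (g : X ⟶ X')
    (p' : X' ⟶ B) : Prop :=
  ∃ (ι : Type w) (Y : ι → C) (h : ∀ i, X ⟶ Y i) (q : ∀ i, Y i ⟶ B),
    (∀ i, N (h i) ∧ h i ≫ q i = p) ∧
    (∀ (Z : C) (h' : X ⟶ Z) (q' : Z ⟶ B), N h' → h' ≫ q' = p →
      ∃! i, ∃ e : Y i ≅ Z, h i ≫ e.hom = h' ∧ e.hom ≫ q' = q i) ∧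
    IsInducedMultiplePushout g p' Y h q

/-- One step of the loose construction over `B`, from `p : X ⟶ B` to `p' : X' ⟶ B`: the family
`h i` represents exactly once each isomorphism class, in `X ↓ C`, of those members of `N` through
which `p` factors, the factorization `p = h i ≫ q i` being chosen for each `i`, and `X'` is
the multiple pushout of the morphisms `h i`. -/
def IsLooseStep (N : MorphismProperty C) {B X X' : C} (p : X ⟶ B) (g : X ⟶ X')
    (p' : X' ⟶ B) : Prop :=
  ∃ (ι : Type w) (Y : ι → C) (h : ∀ i, X ⟶ Y i) (q : ∀ i, Y i ⟶ B),
    (∀ i, N (h i) ∧ h i ≫ q i = p) ∧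
    (∀ (Z : C) (h' : X ⟶ Z), N h' → (∃ q' : Z ⟶ B, h' ≫ q' = p) →
      ∃! i, ∃ e : Y i ≅ Z, h i ≫ e.hom = h') ∧
    IsInducedMultiplePushout g p' Y h q

/-- The least element of the initial ordinal of a regular cardinal. -/
noncomputable abbrev ordOrderBot (κ : Cardinal.{w}) [Fact κ.IsRegular] :
    OrderBot κ.ord.ToType :=
  have : Nonempty κ.ord.ToType := Cardinal.nonempty_ord_toType (Cardinal.IsRegular.ne_zero Fact.out)
  WellFoundedLT.toOrderBot κ.ord.ToType

/-- A factorization `f = left ≫ right` obtained by iterating a one-step construction along the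
initial ordinal of `κ`: a well-order continuous chain `X_α` (`α < κ`) starting at `A`, with
colimit `mid`, such that `X_{α+1}` is obtained by the given step from the composite
`X_α ⟶ mid ⟶ B`. -/
structure IteratedFactorization (κ : Cardinal.{w}) [Fact κ.IsRegular]
    (step : ∀ {B X X' : C}, (X ⟶ B) → (X ⟶ X') → (X' ⟶ B) → Prop)
    {A B : C} (f : A ⟶ B) where
  /-- the colimit of the chain -/
  mid : C
  /-- the canonical morphism from the start of the chain to its colimit -/
  left : A ⟶ mid
  /-- the induced morphism from the colimit of the chain -/
  right : mid ⟶ B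
  fac : left ≫ right = f
  /-- the chain -/
  chain : letI := ordOrderBot κ
    TransfiniteCompositionOfShape κ.ord.ToType left
  step_mem : letI := ordOrderBot κ
    ∀ α : κ.ord.ToType, step (chain.incl.app α ≫ right)
      (chain.F.map (homOfLE (Order.le_succ α))) (chain.incl.app (Order.succ α) ≫ right)

/-- The strict factorizations of `f` (with respect to `N` and `κ`). -/
abbrev StrictFactorization (κ : Cardinal.{w}) [Fact κ.IsRegular] (N : MorphismProperty C)
    {A B : C} (f : A ⟶ B) :=
  IteratedFactorization κ (fun p g p' => IsStrictStep.{w} N p g p') f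

/-- The loose factorizations of `f` (with respect to `N` and `κ`). -/
abbrev LooseFactorization (κ : Cardinal.{w}) [Fact κ.IsRegular] (N : MorphismProperty C)
    {A B : C} (f : A ⟶ B) :=
  IteratedFactorization κ (fun p g p' => IsLooseStep.{w} N p g p') f

end

end PresentableMorphisms

/-!
# Presentable morphisms in a locally presentable category

Throughout, `C` is locally `κ`-presentable. Everything rests on a description of the
`κ`-presentable morphisms out of `A`: every morphism is a `κ`-filtered colimit, in the category of
arrows, of morphisms between `κ`-presentable objects (`exists_arrow_colimitPresentation`), so that
in `Under A` it is a `κ`-filtered colimit of cobase changes to `A` of such morphisms, and a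
`κ`-presentable morphism is a retract of one of these cobase changes
(`exists_retract_pushout_of_presentableMor`). Conversely, morphisms between `κ`-presentable objects
and their cobase changes are `κ`-presentable.

*Triviality of the weak factorization system.* The morphisms `⊥_ C ⟶ X` and `X ⨿ X ⟶ X`, for `X` a
`κ`-presentable object, are `κ`-presentable. Lifting or extending along them detects existence and
uniqueness of factorizations through `κ`-presentable objects, which generate `C`: hence only
isomorphisms have the right lifting property, only terminal objects are injective, and pure
morphisms are monomorphisms. In the other direction, if `f : A ⟶ B` is the colimit of the morphisms
`L j ⟶ R j`, then `B` arises from `A` by attaching the cells `L j ⟶ R j` one at a time, and then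
imposing, one at a time, the relations given by the arrows of the indexing category. A cell is
attached by a cobase change of `L j ⟶ R j`, and a relation imposed by a cobase change of a
codiagonal `R i ⨿ R i ⟶ R i`. So every `f` is a transfinite composition of `κ`-presentable morphisms
(`transfiniteCompositions_presentableMor`).

*The iterated factorizations.* The description of `κ`-presentable morphisms out of `A` shows that
there is a small set of them up to isomorphism (`PresentableCode`), so the strict and loose steps
exist and may be iterated. As the chain has length `κ`, a morphism from a `κ`-presentable object
to the middle object factors through some stage `X_α`; pushing out a morphism `z` between
`κ`-presentable objects to `X_α` gives one of the morphisms used to build `X_{α+1}`, hence a lift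
of `z`. In the strict case the lift is compatible with the morphism to `B` and the right factor is
an isomorphism; in the loose case it need not be, and the right factor is `κ`-pure.

*Size control.* If `γ ◁ β`, every `β`-presentable object has a dense family of fewer than `β`
morphisms from `γ`-presentable objects (`exists_isDenseFamily`), which bounds the number of
morphisms from a `γ`-presentable object to a `β`-presentable one. If moreover there are fewer than
`β` isomorphism classes of `γ`-presentable objects, fewer than `β` codes exist over each
`β`-presentable `X_α`, so each step, and finally the middle object, is a colimit of size `< β` of
`β`-presentable objects (`isCardinalPresentable_mid`). To find `γ`, choose `μ` bounding the number
of morphisms between `κ`-presentable objects and take `γ = (2 ^ μ)⁺`. Then `κ ◁ γ`, and a dense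
family of size `2 ^ μ` determines a `γ`-presentable object, so there are at most `2 ^ 2 ^ μ ≤ γ ^
(2 ^ μ) ≤ γ ^ (< γ)` of them up to isomorphism, and likewise for the morphisms between two of
them. For the existence of pure subobjects the loose `κ`-factorization and `β = (2 ^ μ)⁺` suffice.
-/

namespace PresentableMorphisms

/-! ### Presentable morphisms and pushouts -/

section

variable {C : Type u} [Category.{v} C] {κ : Cardinal.{w}} [Fact κ.IsRegular]

/-- An elementwise criterion for `κ`-presentability. -/
lemma isCardinalPresentable_of_exists {X : C}
    (hsurj : ∀ (J : Type w) [SmallCategory J] [IsCardinalFiltered J κ] (F : J ⥤ C) (c : Cocone F),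
      IsColimit c → ∀ f : X ⟶ c.pt, ∃ (j : J) (g : X ⟶ F.obj j), g ≫ c.ι.app j = f)
    (hinj : ∀ (J : Type w) [SmallCategory J] [IsCardinalFiltered J κ] (F : J ⥤ C) (c : Cocone F),
      IsColimit c → ∀ (j : J) (f g : X ⟶ F.obj j), f ≫ c.ι.app j = g ≫ c.ι.app j →
        ∃ (k : J) (a : j ⟶ k), f ≫ F.map a = g ≫ F.map a) :
    IsCardinalPresentable X κ where
  preservesColimitOfShape J _ _ := ⟨fun {F} ↦ ⟨fun {c} hc ↦ ⟨by
    have := isFiltered_of_isCardinalFiltered J κ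
    refine Types.FilteredColimit.isColimitOf' _ _ (fun f ↦ ?_) (fun j f₁ f₂ hf ↦ ?_)
    · obtain ⟨i, g, hg⟩ := hsurj J F c hc f
      exact ⟨i, g, hg.symm⟩
    · exact hinj J F c hc j f₁ f₂ hf⟩⟩⟩

/-- A morphism between `κ`-presentable objects is a `κ`-presentable morphism. -/
lemma presentableMor_of_isCardinalPresentable {X Y : C} (z : X ⟶ Y)
    [IsCardinalPresentable X κ] [IsCardinalPresentable Y κ] : presentableMor C κ z := by
  refine isCardinalPresentable_of_exists (fun J _ _ F c hc f ↦ ?_)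
    (fun J _ _ F c hc j f g hfg ↦ ?_)
  · have := isFiltered_of_isCardinalFiltered J κ
    have hc' := isColimitOfPreserves (Under.forget X) hc
    obtain ⟨j, g, hg⟩ := IsCardinalPresentable.exists_hom_of_isColimit κ hc' (X := Y) f.right
    dsimp at g hg
    obtain ⟨k, a, ha⟩ := IsCardinalPresentable.exists_eq_of_isColimit' κ hc'
      (z ≫ g) (F.obj j).hom (by
        have h₁ := Under.w f
        have h₂ := Under.w (c.ι.app j)
        dsimp at h₁ h₂ ⊢
        rw [Category.assoc, hg, h₁]
        exact h₂.symm)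
    dsimp at ha
    refine ⟨k, Under.homMk (g ≫ (F.map a).right) ?_, ?_⟩
    · dsimp
      rw [← Category.assoc, ha]
      exact Under.w (F.map a)
    · ext
      have : (F.map a).right ≫ (c.ι.app k).right = (c.ι.app j).right :=
        congr_arg CommaMorphism.right (c.w a)
      change (g ≫ (F.map a).right) ≫ (c.ι.app k).right = f.right
      rw [Category.assoc, this, hg]
  · have := isFiltered_of_isCardinalFiltered J κ
    have hc' := isColimitOfPreserves (Under.forget X) hc
    obtain ⟨k, a, ha⟩ := IsCardinalPresentable.exists_eq_of_isColimit' κ hc' (X := Y)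
      f.right g.right
      (congr_arg CommaMorphism.right hfg)
    exact ⟨k, a, by ext; exact ha⟩

/-- `κ`-presentable morphisms are stable under cobase change. -/
lemma presentableMor_of_isPushout {X Y A B : C} {z : X ⟶ Y} {a : X ⟶ A} {b : Y ⟶ B} {f : A ⟶ B}
    (sq : IsPushout z a b f) (hz : presentableMor C κ z) : presentableMor C κ f := by
  have : IsCardinalPresentable (Under.mk z) κ := hz
  have hc {J : Type w} [SmallCategory J] [IsCardinalFiltered J κ] {F : J ⥤ Under A} {c : Cocone F}
      (hc : IsColimit c) : IsColimit ((Under.map a).mapCocone c) := by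
    have := isFiltered_of_isCardinalFiltered J κ
    have := IsFiltered.nonempty (C := J)
    exact IsColimit.ofIsoColimit (Under.isColimitLiftCocone (F ⋙ Under.forget A)
      { app j := a ≫ (F.obj j).hom
        naturality i j φ := by
          have := Under.w (F.map φ)
          dsimp at this ⊢
          rw [Category.id_comp, Category.assoc, this] }
      ((Under.forget A).mapCocone c) (a ≫ c.pt.hom)
      (fun j ↦ by
        have := Under.w (c.ι.app j)
        dsimp at this ⊢
        rw [Category.assoc, this]) (isColimitOfPreserves _ hc))
      (Cocone.ext (Iso.refl _) (fun j ↦ by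
        ext
        exact Category.comp_id _))
  refine isCardinalPresentable_of_exists (fun J _ _ F c hc₀ g ↦ ?_)
    (fun J _ _ F c hc₀ j g₁ g₂ hg ↦ ?_)
  · have hg : f ≫ g.right = c.pt.hom := Under.w g
    obtain ⟨j, φ, h₁, h₂⟩ : ∃ (j : J) (φ : Y ⟶ (F.obj j).right), z ≫ φ = a ≫ (F.obj j).hom ∧
        φ ≫ (c.ι.app j).right = b ≫ g.right := by
      obtain ⟨j, φ, hφ⟩ := IsCardinalPresentable.exists_hom_of_isColimit κ (hc hc₀)
        (X := Under.mk z) (Under.homMk (V := (Under.map a).obj c.pt) (by exact b ≫ g.right) (by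
          change z ≫ b ≫ g.right = a ≫ c.pt.hom
          rw [sq.w_assoc, hg]))
      exact ⟨j, φ.right, Under.w φ, congr_arg CommaMorphism.right hφ⟩
    have h₃ : (F.obj j).hom ≫ (c.ι.app j).right = c.pt.hom := Under.w (c.ι.app j)
    refine ⟨j, Under.homMk (sq.desc φ (F.obj j).hom h₁) (sq.inr_desc _ _ _), ?_⟩
    ext
    change sq.desc φ (F.obj j).hom h₁ ≫ (c.ι.app j).right = g.right
    apply sq.hom_ext
    · rw [sq.inl_desc_assoc, h₂]
    · rw [sq.inr_desc_assoc, h₃, hg]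
  · have h₁ : f ≫ g₁.right = (F.obj j).hom := Under.w g₁
    have h₂ : f ≫ g₂.right = (F.obj j).hom := Under.w g₂
    have hg' : g₁.right ≫ (c.ι.app j).right = g₂.right ≫ (c.ι.app j).right :=
      congr_arg CommaMorphism.right hg
    obtain ⟨k, u, hu⟩ : ∃ (k : J) (u : j ⟶ k),
        (b ≫ g₁.right) ≫ (F.map u).right = (b ≫ g₂.right) ≫ (F.map u).right := by
      let ψ (g : B ⟶ (F.obj j).right) (hg : f ≫ g = (F.obj j).hom) :
          Under.mk z ⟶ (F ⋙ Under.map a).obj j :=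
        Under.homMk (V := (Under.map a).obj (F.obj j)) (by exact b ≫ g) (by
          change z ≫ b ≫ g = a ≫ (F.obj j).hom
          rw [sq.w_assoc, hg])
      obtain ⟨k, u, hu⟩ := IsCardinalPresentable.exists_eq_of_isColimit' κ (hc hc₀)
        (ψ g₁.right h₁) (ψ g₂.right h₂) (by
          ext
          change (b ≫ g₁.right) ≫ (c.ι.app j).right = (b ≫ g₂.right) ≫ (c.ι.app j).right
          rw [Category.assoc, Category.assoc, hg'])
      exact ⟨k, u, congr_arg CommaMorphism.right hu⟩
    refine ⟨k, u, ?_⟩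
    ext
    change g₁.right ≫ (F.map u).right = g₂.right ≫ (F.map u).right
    apply sq.hom_ext
    · simpa using hu
    · rw [reassoc_of% h₁, reassoc_of% h₂]

end

/-! ### Presentable morphisms are retracts of pushouts of small ones -/

section

variable {C : Type u} [Category.{v} C] (κ : Cardinal.{w}) [Fact κ.IsRegular]

lemma locallySmall_arrow [LocallySmall.{w} C] : LocallySmall.{w} (Arrow C) where
  hom_small f g := small_of_injective
    (f := fun φ : f ⟶ g ↦ ((φ.left, φ.right) : (f.left ⟶ g.left) × (f.right ⟶ g.right)))
    (fun φ ψ h ↦ by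
      simp only [Prod.mk.injEq] at h
      exact Arrow.hom_ext _ _ h.1 h.2)

variable (C) in
lemma isCardinalPresentable_initial [LocallySmall.{w} C] [HasInitial C] :
    IsCardinalPresentable (⊥_ C) κ := by
  have (k : Discrete PEmpty.{1}) : IsCardinalPresentable ((Functor.empty.{0} C).obj k) κ :=
    k.as.elim
  exact isCardinalPresentable_of_isColimit _ (colimit.isColimit (Functor.empty.{0} C)) κ
    (hasCardinalLT_of_finite _ _ (Cardinal.IsRegular.aleph0_le Fact.out))

lemma isCardinalPresentable_arrow_id [HasColimitsOfSize.{w, w} C] (G : C)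
    [IsCardinalPresentable G κ] : IsCardinalPresentable (Arrow.mk (𝟙 G)) κ := by
  refine isCardinalPresentable_of_exists (fun J _ _ F c hc f ↦ ?_)
    (fun J _ _ F c hc j f g hfg ↦ ?_)
  · obtain ⟨j, g, hg⟩ : ∃ (j : J) (g : G ⟶ (F.obj j).left), g ≫ (c.ι.app j).left = f.left :=
      IsCardinalPresentable.exists_hom_of_isColimit κ
        (isColimitOfPreserves Arrow.leftFunc hc) (X := G) f.left
    refine ⟨j, Arrow.homMk (f := Arrow.mk (𝟙 _)) g (g ≫ (F.obj j).hom)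
      (Category.id_comp _).symm, ?_⟩
    ext
    · exact hg
    · change (g ≫ (F.obj j).hom) ≫ (c.ι.app j).right = f.right
      have h : f.left ≫ c.pt.hom = f.right := (Arrow.w f).trans (Category.id_comp _)
      rw [Category.assoc, ← Arrow.w (c.ι.app j), reassoc_of% hg]
      exact h
  · obtain ⟨k, a, ha⟩ : ∃ (k : J) (a : j ⟶ k),
        f.left ≫ (F.map a).left = g.left ≫ (F.map a).left :=
      IsCardinalPresentable.exists_eq_of_isColimit' κ
        (isColimitOfPreserves Arrow.leftFunc hc) (X := G) f.left g.left
        (congr_arg CommaMorphism.left hfg)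
    refine ⟨k, a, ?_⟩
    ext
    · exact ha
    · change f.right ≫ (F.map a).right = g.right ≫ (F.map a).right
      have h₁ : f.left ≫ (F.obj j).hom = f.right := (Arrow.w f).trans (Category.id_comp _)
      have h₂ : g.left ≫ (F.obj j).hom = g.right := (Arrow.w g).trans (Category.id_comp _)
      rw [← h₁, ← h₂, Category.assoc, Category.assoc, ← Arrow.w (F.map a), reassoc_of% ha]

lemma isCardinalPresentable_arrow_initial [HasColimitsOfSize.{w, w} C] (G : C)
    [IsCardinalPresentable G κ] : IsCardinalPresentable (Arrow.mk (initial.to G)) κ := by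
  refine isCardinalPresentable_of_exists (fun J _ _ F c hc f ↦ ?_)
    (fun J _ _ F c hc j f g hfg ↦ ?_)
  · obtain ⟨j, g, hg⟩ : ∃ (j : J) (g : G ⟶ (F.obj j).right), g ≫ (c.ι.app j).right = f.right :=
      IsCardinalPresentable.exists_hom_of_isColimit κ
        (isColimitOfPreserves Arrow.rightFunc hc) (X := G) f.right
    refine ⟨j, Arrow.homMk (f := Arrow.mk (initial.to G)) (initial.to _) g
      (initial.hom_ext _ _), ?_⟩
    ext
    · exact initial.hom_ext _ _
    · exact hg
  · obtain ⟨k, a, ha⟩ : ∃ (k : J) (a : j ⟶ k),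
        f.right ≫ (F.map a).right = g.right ≫ (F.map a).right :=
      IsCardinalPresentable.exists_eq_of_isColimit' κ
        (isColimitOfPreserves Arrow.rightFunc hc) (X := G) f.right g.right
        (congr_arg CommaMorphism.right hfg)
    refine ⟨k, a, ?_⟩
    ext
    · exact initial.hom_ext _ _
    · exact ha

/-- In a locally `κ`-presentable category, any morphism is, in the category of arrows, a
`κ`-filtered colimit of morphisms between `κ`-presentable objects: the arrows `𝟙 G` and
`⊥_ C ⟶ G`, for `G` in a strong generator, form a strong generator of the category of arrows. -/
lemma exists_arrow_colimitPresentation [IsCardinalLocallyPresentable C κ] (f : Arrow C) :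
    ∃ (J : Type w) (_ : SmallCategory J) (_ : IsCardinalFiltered J κ)
      (p : ColimitPresentation J f),
      ∀ j, IsCardinalPresentable (p.diag.obj j).left κ ∧
        IsCardinalPresentable (p.diag.obj j).right κ := by
  have := locallySmall_arrow.{w} (C := C)
  have : HasColimitsOfSize.{w, w} (Arrow C) := ⟨fun J _ ↦ inferInstance⟩
  obtain ⟨P₀, _, h₁, h₂⟩ :=
    (IsCardinalLocallyPresentable.iff_exists_isStrongGenerator C κ).1 inferInstance
  let φ : Subtype P₀ ⊕ Subtype P₀ → Arrow C :=
    Sum.elim (fun X ↦ Arrow.mk (𝟙 X.1)) (fun X ↦ Arrow.mk (initial.to X.1))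
  let P : ObjectProperty (Arrow C) := ObjectProperty.ofObj φ
  have hsmall : Small.{w} (Subtype P₀) := inferInstanceAs (ObjectProperty.Small.{w} P₀)
  have : ObjectProperty.Small.{w} P := inferInstance
  have hleft (X : C) (hX : P₀ X) : P (Arrow.mk (𝟙 X)) :=
      ObjectProperty.ofObj_apply φ (Sum.inl ⟨X, hX⟩)
  have hright (X : C) (hX : P₀ X) : P (Arrow.mk (initial.to X)) :=
      ObjectProperty.ofObj_apply φ (Sum.inr ⟨X, hX⟩)
  have hP : P.IsStrongGenerator := by
    rw [ObjectProperty.isStrongGenerator_iff]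
    refine ⟨fun A B a b h ↦ ?_, fun A B i _ h ↦ ?_⟩
    · apply Arrow.hom_ext
      · refine h₁.isSeparating _ _ (fun G hG g ↦ ?_)
        exact congr_arg CommaMorphism.left (h _ (hleft G hG) (Arrow.homMk g (g ≫ A.hom)))
      · refine h₁.isSeparating _ _ (fun G hG g ↦ ?_)
        exact congr_arg CommaMorphism.right
          (h _ (hright G hG) (Arrow.homMk (initial.to _) g (by simp)))
    · have hl : IsIso i.left := by
        have : Mono i.left := by
          rw [h₁.isSeparating.mono_iff]
          intro G hG a b hab
          have := (cancel_mono i).1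
            (show Arrow.homMk (f := Arrow.mk (𝟙 G)) a (a ≫ A.hom) ≫ i =
              Arrow.homMk b (b ≫ A.hom) ≫ i by
                ext
                · exact hab
                · replace hab : a ≫ i.left = b ≫ i.left := hab
                  change (a ≫ A.hom) ≫ i.right = (b ≫ A.hom) ≫ i.right
                  rw [Category.assoc, Category.assoc, ← Arrow.w i, reassoc_of% hab])
          exact congr_arg CommaMorphism.left this
        refine h₁.isIso_of_mono _ (fun G hG g ↦ ?_)
        obtain ⟨g', hg'⟩ := h _ (hleft G hG) (Arrow.homMk g (g ≫ B.hom))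
        exact ⟨g'.left, congr_arg CommaMorphism.left hg'⟩
      have hr : IsIso i.right := by
        have : Mono i.right := by
          rw [h₁.isSeparating.mono_iff]
          intro G hG a b hab
          have := (cancel_mono i).1
            (show Arrow.homMk (f := Arrow.mk (initial.to G)) (initial.to _) a (by simp) ≫ i =
              Arrow.homMk (initial.to _) b (by simp) ≫ i by
                ext
                · exact initial.hom_ext _ _
                · exact hab)
          exact congr_arg CommaMorphism.right this
        refine h₁.isIso_of_mono _ (fun G hG g ↦ ?_)
        obtain ⟨g', hg'⟩ := h _ (hright G hG) (Arrow.homMk (initial.to _) g (by simp))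
        exact ⟨g'.right, congr_arg CommaMorphism.right hg'⟩
      exact Arrow.isIso_of_isIso_left_of_isIso_right i
  let Q : ObjectProperty (Arrow C) := fun g ↦
    IsCardinalPresentable g.left κ ∧ IsCardinalPresentable g.right κ
  have : Q.IsClosedUnderIsomorphisms := ⟨fun {X Y} e h ↦ by
    have : IsCardinalPresentable (Arrow.leftFunc.obj X) κ := h.1
    have : IsCardinalPresentable (Arrow.rightFunc.obj X) κ := h.2
    exact ⟨isCardinalPresentable_of_iso (Arrow.leftFunc.mapIso e) κ,
      isCardinalPresentable_of_iso (Arrow.rightFunc.mapIso e) κ⟩⟩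
  have hPQ : P ≤ Q := by
    have hG (G : Subtype P₀) : IsCardinalPresentable G.1 κ := h₂ _ G.2
    have := isCardinalPresentable_initial C κ
    rintro _ ⟨G | G⟩
    · exact ⟨hG G, hG G⟩
    · exact ⟨this, hG G⟩
  have hQ : P.colimitsCardinalClosure κ ≤ Q :=
    P.colimitsCardinalClosure_le κ (fun J _ hJ ↦ ⟨by
      rintro X ⟨hX⟩
      have h (j : J) := hX.prop_diag_obj j
      have (j : J) : IsCardinalPresentable ((hX.diag ⋙ Arrow.leftFunc).obj j) κ := (h j).1
      have (j : J) : IsCardinalPresentable ((hX.diag ⋙ Arrow.rightFunc).obj j) κ := (h j).2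
      exact ⟨isCardinalPresentable_of_isColimit _
          (isColimitOfPreserves Arrow.leftFunc hX.isColimit) κ hJ,
        isCardinalPresentable_of_isColimit _
          (isColimitOfPreserves Arrow.rightFunc hX.isColimit) κ hJ⟩⟩) hPQ
  have hPκ : P ≤ isCardinalPresentable (Arrow C) κ := by
    have hG (G : Subtype P₀) : IsCardinalPresentable G.1 κ := h₂ _ G.2
    rintro _ ⟨G | G⟩
    · have := hG G
      exact isCardinalPresentable_arrow_id κ _
    · have := hG G
      exact isCardinalPresentable_arrow_initial κ _
  have := hP.isDense_colimitsCardinalClosure_ι hPκ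
  obtain ⟨J, _, _, ⟨p⟩⟩ := (IsCardinalFilteredGenerator.of_isDense_ι _ _
    (P.colimitsCardinalClosure_le_isCardinalPresentable hPκ)).exists_colimitsOfShape f
  exact ⟨J, _, inferInstance, p.toColimitPresentation, fun j ↦ hQ _ (p.prop_diag_obj j)⟩

end

section

variable {C : Type u} [Category.{v} C]

section

variable [HasPushouts C] {J : Type w} [SmallCategory J] {A B : C} {L R : J ⥤ C} (z : L ⟶ R)
  (a : ∀ j, L.obj j ⟶ A) (ha : ∀ ⦃i j : J⦄ (φ : i ⟶ j), L.map φ ≫ a j = a i)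

/-- The diagram in `Under A` of the cobase changes to `A` of the morphisms `L j ⟶ R j`, given a
natural transformation `L ⟶ R` and a cocone from `L` to `A`. -/
@[simps]
noncomputable def pushoutDiagram : J ⥤ Under A where
  obj j := Under.mk (pushout.inl (a j) (z.app j))
  map {i j} φ := Under.homMk (pushout.desc (pushout.inl _ _) (R.map φ ≫ pushout.inr _ _)
    (by rw [← ha φ, Category.assoc, pushout.condition, ← z.naturality_assoc]))
    (pushout.inl_desc _ _ _)
  map_id j := by
    ext
    apply pushout.hom_ext
    · simp
    · simp
  map_comp φ ψ := by
    ext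
    change pushout.desc _ _ _ = pushout.desc _ _ _ ≫ pushout.desc _ _ _
    apply pushout.hom_ext
    · rw [pushout.inl_desc, pushout.inl_desc_assoc, pushout.inl_desc]
    · rw [pushout.inr_desc, pushout.inr_desc_assoc, Category.assoc, pushout.inr_desc,
        R.map_comp, Category.assoc]

variable {z a} {f : A ⟶ B} (b : ∀ j, R.obj j ⟶ B)
  (hb : ∀ ⦃i j : J⦄ (φ : i ⟶ j), R.map φ ≫ b j = b i)
  (sq : ∀ j, a j ≫ f = z.app j ≫ b j)

/-- The cocone from `pushoutDiagram z a ha` to `f : A ⟶ B` induced by a cocone from `R` to `B`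
that is compatible with the one from `L` to `A`. -/
@[simps]
noncomputable def pushoutCocone : Cocone (pushoutDiagram z a ha) where
  pt := Under.mk f
  ι :=
    { app j := Under.homMk (U := Under.mk (pushout.inl (a j) (z.app j))) (V := Under.mk f)
        (pushout.desc f (b j) (sq j)) (pushout.inl_desc _ _ _)
      naturality i j φ := by
        ext
        change pushout.desc _ _ _ ≫ pushout.desc _ _ _ = pushout.desc _ _ _ ≫ 𝟙 B
        apply pushout.hom_ext
        · rw [pushout.inl_desc_assoc, pushout.inl_desc, Category.comp_id, pushout.inl_desc]
        · rw [pushout.inr_desc_assoc, Category.assoc, pushout.inr_desc, Category.comp_id,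
            pushout.inr_desc, hb] }

/-- If `A` and `B` are the colimits of `L` and `R`, then `f : A ⟶ B` is the colimit in `Under A`
of the cobase changes to `A` of the morphisms `L j ⟶ R j`. -/
noncomputable def isColimitPushoutCocone
    (hl : IsColimit (Cocone.mk A { app := a, naturality i j φ := by simp [ha] }))
    (hr : IsColimit (Cocone.mk B { app := b, naturality i j φ := by simp [hb] })) :
    IsColimit (pushoutCocone ha b hb sq) := by
  refine IsColimit.ofExistsUnique (fun s ↦ ?_)
  obtain ⟨σ, hσ⟩ : ∃ σ : ∀ j, pushout (a j) (z.app j) ⟶ s.pt.right,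
    ∀ j, σ j = (s.ι.app j).right := ⟨fun j ↦ (s.ι.app j).right, fun _ ↦ rfl⟩
  have hs (j : J) : pushout.inl (a j) (z.app j) ≫ σ j = s.pt.hom := by
    rw [hσ]
    exact Under.w (s.ι.app j)
  have hs' {i j : J} (φ : i ⟶ j) : R.map φ ≫ pushout.inr (a j) (z.app j) ≫ σ j =
      pushout.inr (a i) (z.app i) ≫ σ i := by
    have h : ((pushoutDiagram z a ha).map φ).right ≫ (s.ι.app j).right = (s.ι.app i).right :=
      congr_arg CommaMorphism.right (s.w φ)
    rw [hσ i, ← h, ← Category.assoc, ← hσ j]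
    exact (pushout.inr_desc_assoc _ _ _ _).symm
  obtain ⟨d, hd⟩ : ∃ (d : B ⟶ s.pt.right), ∀ j, b j ≫ d =
      pushout.inr (a j) (z.app j) ≫ σ j := by
    let t : Cocone R :=
      { pt := s.pt.right
        ι :=
          { app j := pushout.inr (a j) (z.app j) ≫ σ j
            naturality i j φ := (hs' φ).trans (Category.comp_id _).symm } }
    exact ⟨hr.desc t, hr.fac t⟩
  have hdf : f ≫ d = s.pt.hom := by
    refine hl.hom_ext (fun j ↦ ?_)
    change a j ≫ f ≫ d = a j ≫ s.pt.hom
    rw [reassoc_of% (sq j), hd, ← pushout.condition_assoc, hs]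
  refine ⟨Under.homMk (U := Under.mk f) d hdf, fun j ↦ ?_, fun m hm ↦ ?_⟩
  · ext
    change pushout.desc f (b j) (sq j) ≫ d = (s.ι.app j).right
    rw [← hσ]
    apply pushout.hom_ext
    · rw [pushout.inl_desc_assoc, hs, hdf]
    · rw [pushout.inr_desc_assoc, hd]
  · ext
    obtain ⟨m', hm'⟩ : ∃ m' : B ⟶ s.pt.right, m' = m.right := ⟨_, rfl⟩
    have hm (j : J) : pushout.desc f (b j) (sq j) ≫ m' = σ j := by
      rw [hm', hσ]
      exact congr_arg CommaMorphism.right (hm j)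
    change m.right = d
    rw [← hm']
    refine hr.hom_ext (fun j ↦ ?_)
    change b j ≫ m' = b j ≫ d
    rw [hd, ← hm j, pushout.inr_desc_assoc]

end

/-- The key description of `κ`-presentable morphisms: up to retracts in `Under A`, they are the
cobase changes to `A` of morphisms between `κ`-presentable objects. -/
lemma exists_retract_pushout_of_presentableMor (κ : Cardinal.{w}) [Fact κ.IsRegular]
    [IsCardinalLocallyPresentable C κ] {A B : C} (f : A ⟶ B) (hf : presentableMor C κ f) :
    ∃ (X Y : C) (z : X ⟶ Y) (a : X ⟶ A), IsCardinalPresentable X κ ∧ IsCardinalPresentable Y κ ∧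
      Nonempty (Retract (Under.mk f) (Under.mk (pushout.inl a z))) := by
  have : IsCardinalPresentable (Under.mk f) κ := hf
  obtain ⟨J, _, _, p, hp⟩ := exists_arrow_colimitPresentation κ (Arrow.mk f)
  obtain ⟨j, g, hg⟩ := IsCardinalPresentable.exists_hom_of_isColimit κ
    (isColimitPushoutCocone (z := Functor.whiskerLeft p.diag Arrow.leftToRight)
      (a := fun j ↦ (p.ι.app j).left) (fun i j φ ↦ congr_arg CommaMorphism.left (p.w φ))
      (fun j ↦ (p.ι.app j).right) (fun i j φ ↦ congr_arg CommaMorphism.right (p.w φ))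
      (fun j ↦ Arrow.w (p.ι.app j)) (isColimitOfPreserves Arrow.leftFunc p.isColimit)
      (isColimitOfPreserves Arrow.rightFunc p.isColimit)) (𝟙 (Under.mk f))
  exact ⟨_, _, (p.diag.obj j).hom, (p.ι.app j).left, (hp j).1, (hp j).2, ⟨⟨g, _, hg⟩⟩⟩

end

/-! ### Lifting properties, injectivity and purity -/

section

variable {C : Type u} [Category.{v} C] {κ : Cardinal.{w}} [Fact κ.IsRegular]
  [IsCardinalLocallyPresentable C κ]

lemma isCardinalPresentable_coprod (X Y : C) [IsCardinalPresentable X κ]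
    [IsCardinalPresentable Y κ] : IsCardinalPresentable (X ⨿ Y) κ := by
  have (k : Discrete WalkingPair) : IsCardinalPresentable ((pair X Y).obj k) κ := by
    obtain ⟨_ | _⟩ := k
    · assumption
    · assumption
  exact isCardinalPresentable_of_isColimit _ (colimit.isColimit (pair X Y)) κ
    (hasCardinalLT_of_finite _ _ (Cardinal.IsRegular.aleph0_le Fact.out))

/-- Lifting against the morphisms `⊥_ C ⟶ X` and `X ⨿ X ⟶ X` for `X` a `κ`-presentable object
forces a morphism to be an isomorphism. -/
lemma isIso_of_lifting {A B : C} (p : A ⟶ B)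
    (hp : ∀ ⦃X Y : C⦄, IsCardinalPresentable X κ → IsCardinalPresentable Y κ →
      ∀ (z : X ⟶ Y) (s : X ⟶ A) (t : Y ⟶ B), s ≫ p = z ≫ t →
        ∃ d : Y ⟶ A, z ≫ d = s ∧ d ≫ p = t) : IsIso p := by
  have hG := (isCardinalFilteredGenerator_isCardinalPresentable C κ).isStrongGenerator
  have : Mono p := by
    rw [hG.isSeparating.mono_iff]
    intro X hX a b hab
    have : IsCardinalPresentable X κ := hX
    obtain ⟨d, hd, -⟩ := hp (isCardinalPresentable_coprod X X) hX (coprod.desc (𝟙 X) (𝟙 X))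
      (coprod.desc a b) (a ≫ p) (by ext <;> simp [hab])
    have h₁ := coprod.inl ≫= hd
    have h₂ := coprod.inr ≫= hd
    simp only [coprod.inl_desc_assoc, coprod.inr_desc_assoc, coprod.inl_desc,
      coprod.inr_desc] at h₁ h₂
    rw [← h₁, ← h₂]
  refine hG.isIso_of_mono p (fun X hX t ↦ ?_)
  obtain ⟨d, -, hd⟩ := hp (isCardinalPresentable_initial C κ) hX (initial.to X) (initial.to A) t
    (initial.hom_ext _ _)
  exact ⟨d, hd⟩

variable (C κ) in
lemma presentableMor_rlp_eq : (presentableMor C κ).rlp = MorphismProperty.isomorphisms C := by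
  apply le_antisymm
  · intro A B p hp
    refine isIso_of_lifting (κ := κ) p (fun X Y hX hY z s t sq ↦ ?_)
    have := hp _ (presentableMor_of_isCardinalPresentable (κ := κ) z)
    exact ⟨(CommSq.mk sq).lift, (CommSq.mk sq).fac_left, (CommSq.mk sq).fac_right⟩
  · intro A B p hp X Y z hz
    have : IsIso p := hp
    infer_instance

lemma injectives_presentableMor_iff (K : C) :
    injectives (presentableMor C κ) K ↔ Nonempty (IsTerminal K) := by
  constructor
  · intro hK
    have h₁ (X : C) [IsCardinalPresentable X κ] (a b : X ⟶ K) : a = b := by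
      have := isCardinalPresentable_coprod (κ := κ) X X
      obtain ⟨d, hd⟩ := hK (coprod.desc (𝟙 X) (𝟙 X))
        (presentableMor_of_isCardinalPresentable _) (coprod.desc a b)
      have h₁ := coprod.inl ≫= hd
      have h₂ := coprod.inr ≫= hd
      simp only [coprod.inl_desc_assoc, coprod.inr_desc_assoc, coprod.inl_desc,
        coprod.inr_desc] at h₁ h₂
      rw [← h₁, ← h₂]
    have h₂ (X : C) [IsCardinalPresentable X κ] : Nonempty (X ⟶ K) := by
      have := isCardinalPresentable_initial C κ
      obtain ⟨d, -⟩ := hK (initial.to X) (presentableMor_of_isCardinalPresentable _)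
        (initial.to K)
      exact ⟨d⟩
    have h₃ (Z : C) : Nonempty (Unique (Z ⟶ K)) := by
      obtain ⟨J, _, _, ⟨q⟩⟩ :=
        (isCardinalFilteredGenerator_isCardinalPresentable C κ).exists_colimitsOfShape Z
      have (j : J) : IsCardinalPresentable (q.diag.obj j) κ := q.prop_diag_obj j
      exact ⟨
        { default := q.isColimit.desc (Cocone.mk K
            { app j := (h₂ (q.diag.obj j)).some
              naturality _ _ _ := h₁ _ _ _ })
          uniq g := q.isColimit.hom_ext (fun j ↦ h₁ _ _ _) }⟩
    exact ⟨IsTerminal.ofUniqueHom (fun Z ↦ (h₃ Z).some.default) (fun Z g ↦ (h₃ Z).some.uniq g)⟩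
  · rintro ⟨hK⟩ A B n _ u
    exact ⟨hK.from _, hK.hom_ext _ _⟩

/-- Purity may be tested on all `κ`-presentable morphisms: such a morphism is a retract of a
cobase change of a morphism between `κ`-presentable objects. -/
lemma isPure_iff {A B : C} (f : A ⟶ B) :
    IsPure κ f ↔ ∀ ⦃X Y : C⦄ (z : X ⟶ Y) (s : X ⟶ A) (t : Y ⟶ B),
      presentableMor C κ z → s ≫ f = z ≫ t → ∃ d : Y ⟶ A, z ≫ d = s := by
  constructor
  · intro hf X Y z s t hz sq
    obtain ⟨X₀, Y₀, z₀, a, hX₀, hY₀, ⟨r⟩⟩ := exists_retract_pushout_of_presentableMor κ z hz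
    have hi : z ≫ r.i.right = pushout.inl a z₀ := Under.w r.i
    have hr : pushout.inl a z₀ ≫ r.r.right = z := Under.w r.r
    have hir : r.i.right ≫ r.r.right = 𝟙 Y := congr_arg CommaMorphism.right r.retract
    obtain ⟨d, hd⟩ := hf hX₀ hY₀ z₀ (a ≫ s) (pushout.inr _ _ ≫ r.r.right ≫ t) (by
      rw [← pushout.condition_assoc, reassoc_of% hr, Category.assoc, sq])
    exact ⟨r.i.right ≫ pushout.desc s d hd.symm, by
      rw [reassoc_of% hi, pushout.inl_desc]⟩
  · intro hf X Y hX hY z s t sq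
    exact hf z s t (presentableMor_of_isCardinalPresentable z) sq

/-- If `a ≫ f = b ≫ f`, purity applied to the codiagonal `X ⨿ X ⟶ X` and
`coprod.desc a b` shows that `a = b`. -/
lemma IsPure.mono {A B : C} {f : A ⟶ B} (hf : IsPure κ f) : Mono f := by
  have hG := (isCardinalFilteredGenerator_isCardinalPresentable C κ).isStrongGenerator
  rw [hG.isSeparating.mono_iff]
  intro X hX a b hab
  have : IsCardinalPresentable X κ := hX
  obtain ⟨d, hd⟩ := hf (isCardinalPresentable_coprod X X) hX (coprod.desc (𝟙 X) (𝟙 X))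
    (coprod.desc a b) (a ≫ f) (by ext <;> simp [hab])
  have h₁ := coprod.inl ≫= hd
  have h₂ := coprod.inr ≫= hd
  simp only [coprod.inl_desc_assoc, coprod.inr_desc_assoc, coprod.inl_desc,
    coprod.inr_desc] at h₁ h₂
  rw [← h₁, ← h₂]

lemma IsPure.of_le {C : Type u} [Category.{v} C] {κ κ' : Cardinal.{w}} [Fact κ.IsRegular]
    [Fact κ'.IsRegular] (h : κ ≤ κ') {A B : C} {f : A ⟶ B} (hf : IsPure κ' f) : IsPure κ f :=
  fun X Y _ _ ↦ hf (isCardinalPresentable_of_le X h) (isCardinalPresentable_of_le Y h)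

end

/-! ### Transfinite compositions along initial segments -/

section

variable {C : Type u} [Category.{v} C]

/-- For a functor `G` on the subsets of `K`, the cocone with point `G.obj U` on the values of `G`
on a chain of subsets of `U`. -/
@[simps]
def chainCocone {K : Type w} (G : Set K ⥤ C) {T : Type w} [LinearOrder T] {s : T → Set K}
    (hs : Monotone s) {U : Set K} (hU : ∀ t, s t ⊆ U) : Cocone (hs.functor ⋙ G) where
  pt := G.obj U
  ι :=
    { app t := G.map (homOfLE (hU t))
      naturality _ _ _ := (G.map_comp _ _).symm.trans (Category.comp_id _).symm }

/-- A criterion for transfinite compositions: if a functor `G` on the subsets of a well-ordered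
set sends unions of chains to colimits, and the insertion of the next element to a morphism
in `W`, then it sends the inclusion of the empty set to a transfinite composition. -/
lemma transfiniteCompositions_map_empty_univ (W : MorphismProperty C) (K : Type w)
    [LinearOrder K] [WellFoundedLT K] (G : Set K ⥤ C)
    (hW : ∀ k : K, W (G.map (homOfLE (Set.Iio_subset_Iic_self (a := k)))))
    (hG : ∀ (T : Type w) [LinearOrder T] [Nonempty T] (s : T → Set K) (hs : Monotone s)
      (U : Set K) (hU : ∀ t, s t ⊆ U) (_ : ∀ k ∈ U, ∃ t, k ∈ s t),
      Nonempty (IsColimit (chainCocone G hs hU))) :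
    MorphismProperty.transfiniteCompositions.{w} W
      (G.map (homOfLE (Set.empty_subset (Set.univ (α := K))))) := by
  let : SuccOrder (WithTop K) := .ofLinearWellFoundedLT _
  let : OrderBot (WithTop K) := WellFoundedLT.toOrderBot _
  let s (x : WithTop K) : Set K := {k | (k : WithTop K) < x}
  have hs : Monotone s := fun x y h k hk ↦ lt_of_lt_of_le hk h
  have hbot : s ⊥ = ∅ := by
    ext k
    simp [s]
  have hU (x : WithTop K) : s x ⊆ Set.univ := Set.subset_univ _
  have hcoe (k : K) : s k = Set.Iio k := by
    ext
    simp [s]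
  have hsucc (k : K) : s (Order.succ (k : WithTop K)) = Set.Iic k := by
    ext k'
    simp only [s, Set.mem_ofPred_eq, Set.mem_Iic]
    rw [Order.lt_succ_iff_of_not_isMax (by simp), WithTop.coe_le_coe]
  rw [MorphismProperty.transfiniteCompositions_iff]
  refine ⟨WithTop K, inferInstance, inferInstance, inferInstance, inferInstance, ⟨?_⟩⟩
  exact
    { F := hs.functor ⋙ G
      isoBot := G.mapIso (eqToIso hbot)
      isWellOrderContinuous := ⟨fun m hm ↦ by
        have : Nonempty (Set.Iio m) := by
          obtain ⟨k, hk⟩ := not_isMin_iff.1 hm.1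
          exact ⟨k, hk⟩
        exact hG (Set.Iio m) (fun x ↦ s x.1) (fun _ _ h ↦ hs h) (s m) (fun x ↦ hs x.2.le)
          (fun k hk ↦ ⟨⟨Order.succ k, hm.succ_lt hk⟩, by simp [hsucc]⟩)⟩
      incl := (chainCocone G hs hU).ι
      isColimit := (hG (WithTop K) s hs Set.univ hU (fun k _ ↦ ⟨⊤, by simp [s]⟩)).some
      fac := by
        exact (G.map_comp _ _).symm
      map_mem x hx := by
        induction x with
        | top => simp at hx
        | coe k =>
          have aux {U V : Set K} (h : U ⊆ V) (hU : U = Set.Iio k) (hV : V = Set.Iic k) :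
              W (G.map (homOfLE h)) := by
            subst hU hV
            exact hW k
          exact aux _ (hcoe k) (hsucc k) }

end

lemma isPushout_of_existsUnique {C : Type u} [Category.{v} C] {X Y A B : C} {f : X ⟶ Y} {g : X ⟶ A}
    {h : Y ⟶ B} {i : A ⟶ B} (w : f ≫ h = g ≫ i)
    (H : ∀ (Z : C) (u : Y ⟶ Z) (v : A ⟶ Z), f ≫ u = g ≫ v →
      ∃! d : B ⟶ Z, h ≫ d = u ∧ i ≫ d = v) : IsPushout f g h i :=
  ⟨⟨w⟩, ⟨PushoutCocone.isColimitAux' _ (fun s ↦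
    ⟨(H _ _ _ s.condition).choose, (H _ _ _ s.condition).choose_spec.1.1,
      (H _ _ _ s.condition).choose_spec.1.2,
      fun h₁ h₂ ↦ (H _ _ _ s.condition).choose_spec.2 _ ⟨h₁, h₂⟩⟩)⟩⟩

/-! ### Every morphism is a transfinite composition of presentable morphisms -/

section

variable {C : Type u} [Category.{v} C] {J : Type w} [SmallCategory J] {L R : J ⥤ C} (z : L ⟶ R)
  {A : C} (a : ∀ j, L.obj j ⟶ A)

/-- The objects `j` of `J` stand for the cells attached to `A` along `L j ⟶ R j`, and the arrows
of `J` for the relations between these cells. A `PartialCocone z a S Z` is a morphism `A ⟶ Z`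
together with an extension to the cells in `S` that satisfies the relations in `S`. -/
@[ext]
structure PartialCocone (S : Set (J ⊕ Arrow J)) (Z : C) where
  /-- the morphism from the base -/
  base : A ⟶ Z
  /-- the extensions to the cells -/
  cell (j : J) (hj : Sum.inl j ∈ S) : R.obj j ⟶ Z
  fac (j : J) (hj : Sum.inl j ∈ S) : z.app j ≫ cell j hj = a j ≫ base
  rel (φ : Arrow J) (hφ : Sum.inr φ ∈ S) (h₁ : Sum.inl φ.left ∈ S) (h₂ : Sum.inl φ.right ∈ S) :
    R.map φ.hom ≫ cell φ.right h₂ = cell φ.left h₁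

namespace PartialCocone

variable {z a} {S : Set (J ⊕ Arrow J)}

lemma fac_assoc {Z Z' : C} (c : PartialCocone z a S Z) (j : J) (hj : Sum.inl j ∈ S) (g : Z ⟶ Z') :
    z.app j ≫ c.cell j hj ≫ g = a j ≫ c.base ≫ g := by
  rw [← Category.assoc, c.fac, Category.assoc]

/-- The composition of a partial cocone with a morphism. -/
@[simps]
def map {Z Z' : C} (c : PartialCocone z a S Z) (g : Z ⟶ Z') : PartialCocone z a S Z' where
  base := c.base ≫ g
  cell j hj := c.cell j hj ≫ g
  fac j _ := by rw [← Category.assoc, c.fac, Category.assoc]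
  rel φ hφ h₁ h₂ := by rw [← Category.assoc, c.rel φ hφ h₁]

/-- The restriction of a partial cocone to fewer cells and relations. -/
@[simps]
def restrict {S' : Set (J ⊕ Arrow J)} {Z : C} (c : PartialCocone z a S' Z) (h : S ⊆ S') :
    PartialCocone z a S Z where
  base := c.base
  cell j hj := c.cell j (h hj)
  fac j _ := c.fac j _
  rel φ hφ _ _ := c.rel φ (h hφ) _ _

/-- The universal property of a partial cocone. -/
def IsUniversal {Z : C} (c : PartialCocone z a S Z) : Prop :=
  ∀ ⦃Z' : C⦄ (c' : PartialCocone z a S Z'), ∃! g : Z ⟶ Z', c.map g = c'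

variable (z a S) in
lemma exists_isUniversal [HasColimitsOfSize.{w, w} C] :
    ∃ (Z : C) (c : PartialCocone z a S Z), c.IsUniversal := by
  let sh : MultispanShape.{w, w} :=
    { L := {j : J // Sum.inl j ∈ S} ⊕
        {φ : Arrow J // Sum.inr φ ∈ S ∧ Sum.inl φ.left ∈ S ∧ Sum.inl φ.right ∈ S}
      R := Option {j : J // Sum.inl j ∈ S}
      fst := Sum.elim (fun j ↦ some j) (fun φ ↦ some ⟨_, φ.2.2.2⟩)
      snd := Sum.elim (fun j ↦ none) (fun φ ↦ some ⟨_, φ.2.2.1⟩) }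
  let I : MultispanIndex sh C :=
    { left := Sum.elim (fun j ↦ L.obj j.1) (fun φ ↦ R.obj φ.1.left)
      right b := b.elim A (fun j ↦ R.obj j.1)
      fst
        | .inl j => z.app j.1
        | .inr φ => R.map φ.1.hom
      snd
        | .inl j => a j.1
        | .inr φ => 𝟙 _ }
  let c : PartialCocone z a S (multicoequalizer I) :=
    { base := Multicoequalizer.π I none
      cell j hj := Multicoequalizer.π I (some ⟨j, hj⟩)
      fac j hj := Multicoequalizer.condition I (.inl ⟨j, hj⟩)
      rel φ hφ h₁ h₂ := (Multicoequalizer.condition I (.inr ⟨φ, hφ, h₁, h₂⟩)).trans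
        (Category.id_comp _) }
  refine ⟨_, c, fun Z' c' ↦ ⟨Multicoequalizer.desc I Z'
    (fun b ↦ match b with
      | none => c'.base
      | some j => c'.cell j.1 j.2) ?_, ?_, ?_⟩⟩
  · rintro (j | φ)
    · exact c'.fac _ _
    · exact (c'.rel _ φ.2.1 _ _).trans (Category.id_comp _).symm
  · ext
    · exact Multicoequalizer.π_desc I _ _ _ none
    · exact Multicoequalizer.π_desc I _ _ _ (some _)
  · intro g hg
    apply Multicoequalizer.hom_ext
    rintro (_ | j)
    · rw [Multicoequalizer.π_desc]
      exact congr_arg base hg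
    · rw [Multicoequalizer.π_desc]
      exact congr_fun (congr_fun (congr_arg cell hg) j.1) j.2

end PartialCocone

section

variable [HasColimitsOfSize.{w, w} C] (S : Set (J ⊕ Arrow J))

/-- The object obtained from `A` by attaching the cells in `S` and imposing the relations in `S`. -/
noncomputable def attach : C := (PartialCocone.exists_isUniversal z a S).choose

/-- The universal partial cocone. -/
noncomputable def attachCocone : PartialCocone z a S (attach z a S) :=
  (PartialCocone.exists_isUniversal z a S).choose_spec.choose

lemma attachCocone_isUniversal : (attachCocone z a S).IsUniversal :=
  (PartialCocone.exists_isUniversal z a S).choose_spec.choose_spec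

variable {z a S}

/-- The morphism from `attach z a S` induced by a partial cocone. -/
noncomputable def attachDesc {Z : C} (c : PartialCocone z a S Z) : attach z a S ⟶ Z :=
  (attachCocone_isUniversal z a S c).choose

@[simp]
lemma map_attachDesc {Z : C} (c : PartialCocone z a S Z) :
    (attachCocone z a S).map (attachDesc c) = c :=
  (attachCocone_isUniversal z a S c).choose_spec.1

lemma attach_hom_ext {Z : C} {g g' : attach z a S ⟶ Z}
    (h : (attachCocone z a S).map g = (attachCocone z a S).map g') : g = g' :=
  (attachCocone_isUniversal z a S _).unique h rfl

@[simp]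
lemma attachCocone_base_desc {Z : C} (c : PartialCocone z a S Z) :
    (attachCocone z a S).base ≫ attachDesc c = c.base :=
  congr_arg PartialCocone.base (map_attachDesc c)

@[simp]
lemma attachCocone_base_desc_assoc {Z Z' : C} (c : PartialCocone z a S Z) (g : Z ⟶ Z') :
    (attachCocone z a S).base ≫ attachDesc c ≫ g = c.base ≫ g := by
  rw [← Category.assoc, attachCocone_base_desc]

@[simp]
lemma attachCocone_cell_desc {Z : C} (c : PartialCocone z a S Z) (j : J) (hj : Sum.inl j ∈ S) :
    (attachCocone z a S).cell j hj ≫ attachDesc c = c.cell j hj :=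
  congr_fun (congr_fun (congr_arg PartialCocone.cell (map_attachDesc c)) j) hj

@[simp]
lemma attachCocone_cell_desc_assoc {Z Z' : C} (c : PartialCocone z a S Z) (j : J)
    (hj : Sum.inl j ∈ S) (g : Z ⟶ Z') :
    (attachCocone z a S).cell j hj ≫ attachDesc c ≫ g = c.cell j hj ≫ g := by
  rw [← Category.assoc, attachCocone_cell_desc]

lemma attach_hom_ext' {Z : C} {g g' : attach z a S ⟶ Z}
    (h : (attachCocone z a S).base ≫ g = (attachCocone z a S).base ≫ g')
    (h' : ∀ j hj, (attachCocone z a S).cell j hj ≫ g = (attachCocone z a S).cell j hj ≫ g') :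
    g = g' :=
  attach_hom_ext (by ext; exacts [h, h' _ _])

variable (z a) in
/-- `attach` as a functor on the sets of cells and relations. -/
@[simps]
noncomputable def attachFunctor : Set (J ⊕ Arrow J) ⥤ C where
  obj S := attach z a S
  map {S S'} φ := attachDesc ((attachCocone z a S').restrict (leOfHom φ))
  map_id S := attach_hom_ext' (by simp) (by simp)
  map_comp φ ψ := attach_hom_ext' (by simp) (by simp)

/-- `attach` sends unions of chains to colimits. -/
noncomputable def isColimitChainCocone_attachFunctor {T : Type w} [LinearOrder T] [Nonempty T]
    {s : T → Set (J ⊕ Arrow J)} (hs : Monotone s) {U : Set (J ⊕ Arrow J)} (hU : ∀ t, s t ⊆ U)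
    (hU' : ∀ k ∈ U, ∃ t, k ∈ s t) : IsColimit (chainCocone (attachFunctor z a) hs hU) := by
  refine IsColimit.ofExistsUnique (fun c ↦ ?_)
  obtain ⟨γ, hγ⟩ : ∃ γ : ∀ t, attach z a (s t) ⟶ c.pt, ∀ t, γ t = c.ι.app t :=
    ⟨fun t ↦ c.ι.app t, fun _ ↦ rfl⟩
  have hγ' {t t' : T} (h : t ≤ t') :
      attachDesc ((attachCocone z a (s t')).restrict (hs h)) ≫ γ t' = γ t := by
    rw [hγ, hγ]
    exact c.w (homOfLE h)
  have hbase (t t' : T) :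
      (attachCocone z a (s t)).base ≫ γ t = (attachCocone z a (s t')).base ≫ γ t' := by
    wlog h : t ≤ t' generalizing t t'
    · exact (this _ _ (le_of_not_ge h)).symm
    · simp [← hγ' h]
  have hcell (j : J) (t t' : T) (ht : Sum.inl j ∈ s t) (ht' : Sum.inl j ∈ s t') :
      (attachCocone z a (s t)).cell j ht ≫ γ t = (attachCocone z a (s t')).cell j ht' ≫ γ t' := by
    wlog h : t ≤ t' generalizing t t'
    · exact (this _ _ ht' ht (le_of_not_ge h)).symm
    · simp [← hγ' h]
  choose τ hτ using hU'
  let t₀ : T := Classical.arbitrary T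
  let d : PartialCocone z a U c.pt :=
    { base := (attachCocone z a (s t₀)).base ≫ γ t₀
      cell j hj := (attachCocone z a (s (τ _ hj))).cell j (hτ _ hj) ≫ γ _
      fac j hj := by
        rw [← Category.assoc, PartialCocone.fac, Category.assoc, hbase _ t₀]
      rel φ hφ h₁ h₂ := by
        let t := max (τ _ hφ) (max (τ _ h₁) (τ _ h₂))
        have hφ' : Sum.inr φ ∈ s t := hs (le_max_left _ _) (hτ _ hφ)
        have h₁' : Sum.inl φ.left ∈ s t :=
          hs ((le_max_left _ _).trans (le_max_right _ _)) (hτ _ h₁)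
        have h₂' : Sum.inl φ.right ∈ s t :=
          hs ((le_max_right _ _).trans (le_max_right _ _)) (hτ _ h₂)
        rw [hcell _ _ t (hτ _ h₁) h₁', hcell _ _ t (hτ _ h₂) h₂', ← Category.assoc,
          PartialCocone.rel _ φ hφ' h₁'] }
  refine ⟨attachDesc d, fun t ↦ ?_, fun m hm ↦ ?_⟩
  · have h : attachDesc ((attachCocone z a U).restrict (hU t)) ≫ attachDesc d = γ t := by
      apply attach_hom_ext'
      · simp [d, hbase t t₀]
      · intro j hj
        simp [d, hcell j t _ hj (hτ _ (hU t hj))]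
    exact h.trans (hγ t)
  · have hm' (t : T) : attachDesc ((attachCocone z a U).restrict (hU t)) ≫ m = γ t := by
      rw [hγ]
      exact hm t
    change attach z a U ⟶ c.pt at m
    apply attach_hom_ext'
    · simp [d, ← hm']
    · intro j hj
      simp [d, ← hm']

/-- Attaching the cell `j` is a cobase change of `L j ⟶ R j`. -/
lemma isPushout_attachFunctor_map_cell (j : J) {S S' : Set (J ⊕ Arrow J)} (h : S ⊆ S')
    (hj : Sum.inl j ∈ S') (hj' : Sum.inl j ∉ S) (hS : ∀ k, Sum.inl k ∈ S' → k ≠ j → Sum.inl k ∈ S)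
    (hr : ∀ φ, Sum.inr φ ∉ S') :
    IsPushout (z.app j) (a j ≫ (attachCocone z a S).base) ((attachCocone z a S').cell j hj)
      ((attachFunctor z a).map (homOfLE h)) := by
  classical
  refine isPushout_of_existsUnique ?_ (fun Z u v huv ↦ ?_)
  · simp [(attachCocone z a S').fac]
  · let d : PartialCocone z a S' Z :=
      { base := (attachCocone z a S).base ≫ v
        cell k hk :=
          if e : k = j then R.map (eqToHom e) ≫ u else (attachCocone z a S).cell k (hS k hk e) ≫ v
        fac k hk := by
          by_cases e : k = j
          · subst e
            simp [huv]
          · simp [e, (attachCocone z a S).fac_assoc]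
        rel φ hφ := (hr φ hφ).elim }
    refine ⟨attachDesc d, ⟨by simp [d], ?_⟩, fun m hm ↦ ?_⟩
    · apply attach_hom_ext'
      · simp [d]
      · intro k hk
        have hkj : k ≠ j := fun e ↦ hj' (e ▸ hk)
        simp [d, hkj]
    · obtain ⟨rfl, rfl⟩ := hm
      apply attach_hom_ext'
      · simp [d]
      · intro k hk
        by_cases e : k = j
        · subst e
          simp [d]
        · simp [d, e]

/-- Imposing the relation given by `φ : i ⟶ j` is a cobase change of the codiagonal of `R i`. -/
lemma isPushout_attachFunctor_map_rel (φ : Arrow J) {S S' : Set (J ⊕ Arrow J)} (h : S ⊆ S')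
    (hφ : Sum.inr φ ∈ S') (h₁ : Sum.inl φ.left ∈ S) (h₂ : Sum.inl φ.right ∈ S)
    (hS : ∀ k ∈ S', k ≠ Sum.inr φ → k ∈ S) :
    IsPushout (coprod.desc (𝟙 (R.obj φ.left)) (𝟙 (R.obj φ.left)))
      (coprod.desc ((attachCocone z a S).cell _ h₁)
        (R.map φ.hom ≫ (attachCocone z a S).cell _ h₂))
      ((attachCocone z a S').cell _ (h h₁)) ((attachFunctor z a).map (homOfLE h)) := by
  refine isPushout_of_existsUnique ?_ (fun Z u v huv ↦ ?_)
  · change _ = _ ≫ attachDesc ((attachCocone z a S').restrict h)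
    apply coprod.hom_ext
    · rw [coprod.inl_desc_assoc, coprod.inl_desc_assoc]
      simp
    · rw [coprod.inr_desc_assoc, coprod.inr_desc_assoc]
      simp [(attachCocone z a S').rel φ hφ (h h₁) (h h₂)]
  · have hu₁ := coprod.inl ≫= huv
    have hu₂ := coprod.inr ≫= huv
    simp only [coprod.inl_desc_assoc, coprod.inr_desc_assoc, Category.id_comp,
      Category.assoc] at hu₁ hu₂
    let d : PartialCocone z a S' Z :=
      { base := (attachCocone z a S).base ≫ v
        cell k hk := (attachCocone z a S).cell k (hS _ hk (by simp)) ≫ v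
        fac k hk := by simp [(attachCocone z a S).fac_assoc]
        rel ψ hψ h₁' h₂' := by
          by_cases e : ψ = φ
          · subst e
            rw [← hu₂, hu₁]
          · rw [← Category.assoc, (attachCocone z a S).rel ψ (hS _ hψ (by simpa using e))
              (hS _ h₁' (by simp))] }
    refine ⟨attachDesc d, ⟨by simp [d, hu₁], ?_⟩, fun m hm ↦ ?_⟩
    · apply attach_hom_ext'
      · simp [d]
      · simp [d]
    · obtain ⟨rfl, rfl⟩ := hm
      apply attach_hom_ext'
      · simp [d]
      · simp [d]

end

end

lemma exists_wellOrder_sum (α β : Type w) :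
    ∃ (_ : LinearOrder (α ⊕ β)), WellFoundedLT (α ⊕ β) ∧
      ∀ (x : α) (y : β), (Sum.inl x : α ⊕ β) < Sum.inr y := by
  obtain ⟨_, hα⟩ := exists_wellFoundedLT (α := α)
  obtain ⟨_, hβ⟩ := exists_wellFoundedLT (α := β)
  exact ⟨inferInstanceAs (LinearOrder (α ⊕ₗ β)), ⟨Sum.lex_wf hα.wf hβ.wf⟩,
    fun x y ↦ Sum.Lex.sep x y⟩

variable {C : Type u} [Category.{v} C]

/-- If `f : A ⟶ B` is the colimit of the morphisms `z.app j`, then attaching no cell to `A` gives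
`A`, and attaching all the cells and imposing all the relations gives `B`. The cells precede the
relations in the well-order, so that a relation is imposed on two cells already present. -/
lemma transfiniteCompositions_presentableMor_of_isColimit (κ : Cardinal.{w}) [Fact κ.IsRegular]
    [IsCardinalLocallyPresentable C κ] {J : Type w} [SmallCategory J] {A B : C} {L R : J ⥤ C}
    (z : L ⟶ R) (a : ∀ j, L.obj j ⟶ A) (ha : ∀ ⦃i j : J⦄ (φ : i ⟶ j), L.map φ ≫ a j = a i)
    (b : ∀ j, R.obj j ⟶ B) (hb : ∀ ⦃i j : J⦄ (φ : i ⟶ j), R.map φ ≫ b j = b i)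
    (hl : IsColimit (Cocone.mk A { app := a, naturality i j φ := by simp [ha] }))
    (hr : IsColimit (Cocone.mk B { app := b, naturality i j φ := by simp [hb] }))
    (f : A ⟶ B) (sq : ∀ j, a j ≫ f = z.app j ≫ b j)
    (hL : ∀ j, IsCardinalPresentable (L.obj j) κ) (hR : ∀ j, IsCardinalPresentable (R.obj j) κ) :
    MorphismProperty.transfiniteCompositions.{w} (presentableMor C κ) f := by
  obtain ⟨_, _, hlt⟩ := exists_wellOrder_sum J (Arrow J)
  have h := transfiniteCompositions_map_empty_univ (presentableMor C κ) (J ⊕ Arrow J)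
    (attachFunctor z a) ?_
    (fun T _ _ s hs U hU hU' ↦ ⟨isColimitChainCocone_attachFunctor hs hU hU'⟩)
  · rw [MorphismProperty.transfiniteCompositions_iff] at h ⊢
    obtain ⟨K, _, _, _, _, ⟨h⟩⟩ := h
    let c₀ : PartialCocone z a ∅ A :=
      { base := 𝟙 A
        cell j hj := hj.elim
        fac j hj := hj.elim
        rel φ hφ := hφ.elim }
    let c₁ : PartialCocone z a Set.univ B :=
      { base := f
        cell j _ := b j
        fac j _ := (sq j).symm
        rel φ _ _ _ := hb φ.hom }
    let u := attachCocone z a Set.univ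
    obtain ⟨d, hd⟩ : ∃ d : B ⟶ attach z a Set.univ, ∀ j, b j ≫ d = u.cell j (Set.mem_univ _) := by
      let t : Cocone R :=
        { pt := attach z a Set.univ
          ι :=
            { app j := u.cell j (Set.mem_univ _)
              naturality i j φ := (u.rel (Arrow.mk φ) (Set.mem_univ _) (Set.mem_univ _)
                (Set.mem_univ _)).trans (Category.comp_id _).symm } }
      exact ⟨hr.desc t, hr.fac t⟩
    have hfd : f ≫ d = u.base := hl.hom_ext (fun j ↦ by
      change a j ≫ f ≫ d = a j ≫ u.base
      rw [reassoc_of% (sq j), hd, u.fac])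
    let e₀ : attach z a ∅ ≅ A :=
      { hom := attachDesc c₀
        inv := (attachCocone z a ∅).base
        hom_inv_id := attach_hom_ext' (by simp [c₀]) (fun j hj ↦ hj.elim)
        inv_hom_id := by simp [c₀] }
    let e₁ : attach z a Set.univ ≅ B :=
      { hom := attachDesc c₁
        inv := d
        hom_inv_id := attach_hom_ext' (by simp [c₁, hfd, u]) (fun j hj ↦ by simp [c₁, hd, u])
        inv_hom_id := hr.hom_ext (fun j ↦ by
          change b j ≫ d ≫ attachDesc c₁ = b j ≫ 𝟙 B
          rw [reassoc_of% hd j]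
          simp [c₁, u]) }
    refine ⟨K, inferInstance, inferInstance, inferInstance, inferInstance,
      ⟨h.ofArrowIso (Arrow.isoMk (f := Arrow.mk _) (g := Arrow.mk f) e₀ e₁ ?_)⟩⟩
    change attachDesc c₀ ≫ f = attachDesc _ ≫ attachDesc c₁
    exact attach_hom_ext' (by simp [c₀, c₁]) (fun j hj ↦ hj.elim)
  · rintro (j | φ)
    · exact presentableMor_of_isPushout (isPushout_attachFunctor_map_cell j _ (by simp) (by simp)
        (fun k hk e ↦ lt_of_le_of_ne hk (by simpa using e)) (fun φ ↦ by simpa using hlt j φ))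
        (presentableMor_of_isCardinalPresentable _)
    · have := isCardinalPresentable_coprod (κ := κ) (R.obj φ.left) (R.obj φ.left)
      exact presentableMor_of_isPushout (isPushout_attachFunctor_map_rel φ _ (by simp) (hlt _ _)
        (hlt _ _) (fun k hk e ↦ lt_of_le_of_ne hk e)) (presentableMor_of_isCardinalPresentable _)

/-- Every morphism `f : A ⟶ B` is a transfinite composition of `κ`-presentable morphisms: it is a
`κ`-filtered colimit of morphisms between `κ`-presentable objects, and `B` is obtained
from `A` by attaching the corresponding cells and then imposing the relations, one at a time. -/
lemma transfiniteCompositions_presentableMor (κ : Cardinal.{w}) [Fact κ.IsRegular]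
    [IsCardinalLocallyPresentable C κ] {A B : C} (f : A ⟶ B) :
    MorphismProperty.transfiniteCompositions.{w} (presentableMor C κ) f := by
  obtain ⟨J, _, _, p, hp⟩ := exists_arrow_colimitPresentation κ (Arrow.mk f)
  exact transfiniteCompositions_presentableMor_of_isColimit κ
    (Functor.whiskerLeft p.diag Arrow.leftToRight)
    (fun j ↦ (p.ι.app j).left) (fun i j φ ↦ congr_arg CommaMorphism.left (p.w φ))
    (fun j ↦ (p.ι.app j).right) (fun i j φ ↦ congr_arg CommaMorphism.right (p.w φ))
    (isColimitOfPreserves Arrow.leftFunc p.isColimit)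
    (isColimitOfPreserves Arrow.rightFunc p.isColimit) f (fun j ↦ Arrow.w (p.ι.app j))
    (fun j ↦ (hp j).1) (fun j ↦ (hp j).2)

/-! ### A small parametrization of the presentable morphisms -/

section

variable {C : Type u} [Category.{v} C]

/-- If all the elements of a type are determined, up to an equivalence relation, by a code in a
small type, then they have a small skeleton. -/
lemma exists_skeleton {S : Type*} {r : S → S → Prop} (hr : Equivalence r) {T : Type*} [Small.{w} T]
    (code : S → T) (hcode : ∀ s s', code s = code s' → r s s') :
    ∃ (ι : Type w) (f : ι → S), ∀ s, ∃! i, r (f i) s := by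
  let _ : Setoid S := ⟨r, hr⟩
  have hinj : Function.Injective (fun q : Quotient ‹Setoid S› ↦ code q.out) := fun q q' h ↦ by
    rw [← q.out_eq, ← q'.out_eq]
    exact Quotient.sound (hcode _ _ h)
  have := small_of_injective.{w} hinj
  refine ⟨Shrink.{w} (Quotient ‹Setoid S›), fun i ↦ ((equivShrink _).symm i).out, fun s ↦
    ⟨equivShrink _ ⟦s⟧, ?_, fun i hi ↦ ?_⟩⟩
  · dsimp
    rw [Equiv.symm_apply_apply]
    exact Quotient.mk_out s
  · rw [← Equiv.symm_apply_eq, ← Quotient.out_eq ((equivShrink _).symm i)]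
    exact Quotient.sound hi

/-- A family of `κ`-presentable objects which contains every `κ`-presentable object up to
isomorphism. -/
structure IsPresentableFamily (κ : Cardinal.{w}) [Fact κ.IsRegular] {I : Type w} (G : I → C) :
    Prop where
  isCardinalPresentable (i : I) : IsCardinalPresentable (G i) κ
  exists_iso (X : C) (hX : IsCardinalPresentable X κ) : ∃ i, Nonempty (X ≅ G i)

variable (C) in
lemma exists_isPresentableFamily (κ : Cardinal.{w}) [Fact κ.IsRegular]
    [IsCardinalLocallyPresentable C κ] : ∃ (I : Type w) (G : I → C), IsPresentableFamily κ G := by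
  obtain ⟨Q, _, h₁, h₂⟩ :=
    ObjectProperty.EssentiallySmall.exists_small_le.{w} (isCardinalPresentable C κ)
  refine ⟨Shrink.{w} (Subtype Q), fun i ↦ ((equivShrink _).symm i).1,
    ⟨fun i ↦ h₁ _ ((equivShrink _).symm i).2, fun X hX ↦ ?_⟩⟩
  obtain ⟨Y, hY, ⟨e⟩⟩ := h₂ _ hX
  exact ⟨equivShrink _ ⟨Y, hY⟩, by simpa using ⟨e⟩⟩

/-- The codes for the `κ`-presentable morphisms `h : A ⟶ Z`: a morphism `h` is encoded by a
presentation as a retract in `Under A` of a cobase change of a morphism `z` of the family,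
of which only the corresponding idempotent is retained. -/
structure PresentableCode [HasPushouts C] {I : Type w} (G : I → C) (A : C) where
  /-- the index of the domain of `z` -/
  src : I
  /-- the index of the codomain of `z` -/
  tgt : I
  /-- the morphism between `κ`-presentable objects -/
  z : G src ⟶ G tgt
  /-- the attaching morphism -/
  a : G src ⟶ A
  /-- the restriction to the codomain of `z` of the idempotent -/
  e : G tgt ⟶ pushout a z

lemma PresentableCode.injective [HasPushouts C] {I : Type w} {G : I → C} {A : C} :
    Function.Injective (β := Σ (p : I × I), Σ (q : (G p.1 ⟶ G p.2) × (G p.1 ⟶ A)),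
      (G p.2 ⟶ pushout q.2 q.1))
        (fun c : PresentableCode G A ↦ ⟨(c.src, c.tgt), (c.z, c.a), c.e⟩) := by
  rintro ⟨_, _, _, _, _⟩ ⟨_, _, _, _, _⟩ h
  simp only [Sigma.mk.injEq, Prod.mk.injEq] at h
  obtain ⟨⟨rfl, rfl⟩, h⟩ := h
  simp only [heq_eq_eq, Sigma.mk.injEq, Prod.mk.injEq] at h
  obtain ⟨⟨rfl, rfl⟩, h⟩ := h
  simpa using h

lemma PresentableCode.small [HasPushouts C] [LocallySmall.{w} C] {I : Type w} (G : I → C) (A : C) :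
    Small.{w} (PresentableCode G A) :=
  small_of_injective PresentableCode.injective

/-- A presentation of `h : A ⟶ Z` as a retract in `Under A` of a cobase change of a morphism
in the family `G`. -/
structure PresentableMorPresentation [HasPushouts C] {I : Type w} (G : I → C) {A Z : C}
    (h : A ⟶ Z) where
  /-- the index of the domain of `z` -/
  src : I
  /-- the index of the codomain of `z` -/
  tgt : I
  /-- the morphism between `κ`-presentable objects -/
  z : G src ⟶ G tgt
  /-- the attaching morphism -/
  a : G src ⟶ A
  /-- the inclusion -/
  i : Z ⟶ pushout a z
  /-- the retraction -/
  r : pushout a z ⟶ Z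
  i_r : i ≫ r = 𝟙 Z
  h_i : h ≫ i = pushout.inl a z
  inl_r : pushout.inl a z ≫ r = h

namespace PresentableMorPresentation

variable [HasPushouts C] {I : Type w} {G : I → C} {A Z Z' : C} {h : A ⟶ Z} {h' : A ⟶ Z'}

/-- The code of a presentation. -/
@[simps]
noncomputable def code (p : PresentableMorPresentation G h) : PresentableCode G A where
  src := p.src
  tgt := p.tgt
  z := p.z
  a := p.a
  e := pushout.inr _ _ ≫ p.r ≫ p.i

/-- A `κ`-presentable morphism is determined up to isomorphism by its code. -/
lemma exists_iso_of_code_eq (p : PresentableMorPresentation G h)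
    (p' : PresentableMorPresentation G h') (hp : p.code = p'.code) :
    ∃ e : Z ≅ Z', h ≫ e.hom = h' ∧ ∀ ⦃B : C⦄ (q : Z ⟶ B) (q' : Z' ⟶ B),
      (p.r ≫ q ≍ p'.r ≫ q') → e.hom ≫ q' = q := by
  obtain ⟨s, t, z, a, i, r, h₁, h₂, h₃⟩ := p
  obtain ⟨s', t', z', a', i', r', h₁', h₂', h₃'⟩ := p'
  simp only [code, PresentableCode.mk.injEq] at hp
  obtain ⟨rfl, rfl, hp⟩ := hp
  simp only [heq_eq_eq] at hp
  obtain ⟨rfl, rfl, hp⟩ := hp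
  simp only [heq_eq_eq] at hp
  have hri : r ≫ i = r' ≫ i' := by
    apply pushout.hom_ext
    · rw [reassoc_of% h₃, h₂, reassoc_of% h₃', h₂']
    · exact hp
  refine ⟨⟨i ≫ r', i' ≫ r, ?_, ?_⟩, ?_, fun B q q' hq ↦ ?_⟩
  · rw [Category.assoc, ← reassoc_of% hri, h₁, Category.comp_id, h₁]
  · rw [Category.assoc, reassoc_of% hri, h₁', Category.comp_id, h₁']
  · dsimp
    rw [reassoc_of% h₂, h₃']
  · dsimp
    rw [Category.assoc, ← eq_of_heq hq, reassoc_of% h₁]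

end PresentableMorPresentation

lemma IsPresentableFamily.nonempty_presentation {κ : Cardinal.{w}} [Fact κ.IsRegular]
    [IsCardinalLocallyPresentable C κ] {I : Type w} {G : I → C} (hG : IsPresentableFamily κ G)
    {A Z : C} (h : A ⟶ Z) (hh : presentableMor C κ h) :
    Nonempty (PresentableMorPresentation G h) := by
  obtain ⟨X, Y, z, a, hX, hY, ⟨r⟩⟩ := exists_retract_pushout_of_presentableMor κ h hh
  obtain ⟨s, ⟨e⟩⟩ := hG.exists_iso X hX
  obtain ⟨t, ⟨e'⟩⟩ := hG.exists_iso Y hY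
  have hi : h ≫ r.i.right = pushout.inl a z := Under.w r.i
  have hr : pushout.inl a z ≫ r.r.right = h := Under.w r.r
  have hir : r.i.right ≫ r.r.right = 𝟙 Z := congr_arg CommaMorphism.right r.retract
  let f : pushout a z ⟶ pushout (e.inv ≫ a) (e.inv ≫ z ≫ e'.hom) :=
    pushout.desc (pushout.inl _ _) (e'.hom ≫ pushout.inr _ _) (by
      simpa using e.hom ≫= pushout.condition (f := e.inv ≫ a) (g := e.inv ≫ z ≫ e'.hom))
  let g : pushout (e.inv ≫ a) (e.inv ≫ z ≫ e'.hom) ⟶ pushout a z :=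
    pushout.desc (pushout.inl _ _) (e'.inv ≫ pushout.inr _ _) (by simp [pushout.condition])
  have hfg : f ≫ g = 𝟙 _ := by
    apply pushout.hom_ext
    · rw [pushout.inl_desc_assoc, pushout.inl_desc, Category.comp_id]
    · rw [pushout.inr_desc_assoc, Category.assoc, pushout.inr_desc, e'.hom_inv_id_assoc,
        Category.comp_id]
  obtain ⟨i', hi'⟩ : ∃ i' : Z ⟶ pushout a z, i' = r.i.right := ⟨_, rfl⟩
  obtain ⟨r', hr'⟩ : ∃ r' : pushout a z ⟶ Z, r' = r.r.right := ⟨_, rfl⟩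
  rw [← hi'] at hi hir
  rw [← hr'] at hr hir
  exact ⟨
    { src := s
      tgt := t
      z := e.inv ≫ z ≫ e'.hom
      a := e.inv ≫ a
      i := i' ≫ f
      r := g ≫ r'
      i_r := by rw [Category.assoc, reassoc_of% hfg, hir]
      h_i := by rw [reassoc_of% hi, pushout.inl_desc]
      inl_r := by rw [pushout.inl_desc_assoc, hr] }⟩

end

/-! ### Existence of strict and loose factorizations -/

section

variable {C : Type u} [Category.{v} C]

lemma exists_isInducedMultiplePushout [HasWidePushouts.{w} C] {X B : C} (p : X ⟶ B) {ι : Type w}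
    (Y : ι → C) (h : ∀ i, X ⟶ Y i) (q : ∀ i, Y i ⟶ B) (hq : ∀ i, h i ≫ q i = p) :
    ∃ (X' : C) (g : X ⟶ X') (p' : X' ⟶ B), g ≫ p' = p ∧ IsInducedMultiplePushout g p' Y h q :=
  ⟨widePushout X Y h, WidePushout.head h, WidePushout.desc p q hq, WidePushout.head_desc _ _ _ _,
    WidePushout.ι h, WidePushout.arrow_ι h,
    ⟨IsColimit.ofIsoColimit (colimit.isColimit (WidePushoutShape.wideSpan X Y h))
      (Cocone.ext (Iso.refl _) (by rintro (_ | _) <;> exact Category.comp_id _))⟩,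
    WidePushout.ι_desc _ _ _ _⟩

/-- A one-step construction which is always possible can be iterated. -/
lemma nonempty_iteratedFactorization [HasColimitsOfSize.{w, w} C] (κ : Cardinal.{w})
    [Fact κ.IsRegular]
    {step : ∀ {B X X' : C}, (X ⟶ B) → (X ⟶ X') → (X' ⟶ B) → Prop}
    (hstep : ∀ {B X : C} (p : X ⟶ B), ∃ (X' : C) (g : X ⟶ X') (p' : X' ⟶ B),
      g ≫ p' = p ∧ step p g p') {A B : C} (f : A ⟶ B) :
    Nonempty (IteratedFactorization κ step f) := by
  let _ : OrderBot κ.ord.ToType := ordOrderBot κ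
  have : NoMaxOrder κ.ord.ToType := Cardinal.noMaxOrder (Cardinal.IsRegular.aleph0_le Fact.out)
  have (p : Over B) := hstep p.hom
  choose X' g p' hg hs using this
  let Φ : SmallObject.SuccStruct (Over B) :=
    { X₀ := Over.mk f
      succ p := Over.mk (p' p)
      toSucc p := Over.homMk (g p) (hg p) }
  have hΦ {p₁ p₂ : Over B} (φ : p₁ ⟶ p₂) (hφ : Φ.prop φ) : step p₁.hom φ.left p₂.hom := by
    obtain ⟨⟩ := hφ
    exact hs _
  have : HasColimitsOfSize.{w, w} (Over B) := ⟨fun J _ ↦ inferInstance⟩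
  have : PreservesWellOrderContinuousOfShape κ.ord.ToType (Over.forget B) :=
    ⟨fun j _ ↦ inferInstance⟩
  let c := Φ.transfiniteCompositionOfShapeιIteration κ.ord.ToType
  refine ⟨
    { mid := (Φ.iteration κ.ord.ToType).left
      left := (Φ.ιIteration κ.ord.ToType).left
      right := (Φ.iteration κ.ord.ToType).hom
      fac := Over.w (Φ.ιIteration κ.ord.ToType)
      chain := c.toTransfiniteCompositionOfShape.map (Over.forget B)
      step_mem α := ?_ }⟩
  have h := hΦ _ (c.map_mem α (not_isMax _))
  have hc (j : κ.ord.ToType) : (c.F.obj j).hom =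
      (c.toTransfiniteCompositionOfShape.map (Over.forget B)).incl.app j ≫
        (Φ.iteration κ.ord.ToType).hom :=
    (Over.w (c.incl.app j)).symm.trans (congr_arg (· ≫ (Φ.iteration κ.ord.ToType).hom)
      (Category.comp_id (c.incl.app j).left).symm)
  rw [hc, hc] at h
  exact h

variable {κ : Cardinal.{w}} [Fact κ.IsRegular] [IsCardinalLocallyPresentable C κ]

lemma exists_isStrictStep {B X : C} (p : X ⟶ B) : ∃ (X' : C) (g : X ⟶ X') (p' : X' ⟶ B),
    g ≫ p' = p ∧ IsStrictStep.{w} (presentableMor C κ) p g p' := by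
  obtain ⟨I, G, hG⟩ := exists_isPresentableFamily C κ
  have := PresentableCode.small.{w} G X
  let S := {s : Σ (Z : C), (X ⟶ Z) × (Z ⟶ B) // presentableMor C κ s.2.1 ∧ s.2.1 ≫ s.2.2 = p}
  let r (s s' : S) : Prop :=
    ∃ e : s.1.1 ≅ s'.1.1, s.1.2.1 ≫ e.hom = s'.1.2.1 ∧ e.hom ≫ s'.1.2.2 = s.1.2.2
  have hr : Equivalence r :=
    { refl s := ⟨Iso.refl _, by simp⟩
      symm := fun ⟨e, h₁, h₂⟩ ↦ ⟨e.symm, by simp [← h₁, ← h₂]⟩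
      trans := fun ⟨e, h₁, h₂⟩ ⟨e', h₁', h₂'⟩ ↦
        ⟨e ≪≫ e', by simp [reassoc_of% h₁, h₁'], by simp [h₂', h₂]⟩ }
  let pr (s : S) := (hG.nonempty_presentation s.1.2.1 s.2.1).some
  obtain ⟨ι, f, hf⟩ := exists_skeleton hr (T := Σ c : PresentableCode G X, pushout c.a c.z ⟶ B)
    (fun s ↦ ⟨(pr s).code, (pr s).r ≫ s.1.2.2⟩) (fun s s' h ↦ by
      simp only [Sigma.mk.injEq] at h
      obtain ⟨e, he, he'⟩ := (pr s).exists_iso_of_code_eq (pr s') h.1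
      exact ⟨e, he, he' _ _ h.2⟩)
  obtain ⟨X', g, p', hg, hp'⟩ := exists_isInducedMultiplePushout p (fun i ↦ (f i).1.1)
    (fun i ↦ (f i).1.2.1) (fun i ↦ (f i).1.2.2) (fun i ↦ (f i).2.2)
  exact ⟨X', g, p', hg, ι, _, _, _, fun i ↦ (f i).2,
    fun Z h' q' hh' hq' ↦ hf ⟨⟨Z, h', q'⟩, hh', hq'⟩, hp'⟩

lemma exists_isLooseStep {B X : C} (p : X ⟶ B) : ∃ (X' : C) (g : X ⟶ X') (p' : X' ⟶ B),
    g ≫ p' = p ∧ IsLooseStep.{w} (presentableMor C κ) p g p' := by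
  obtain ⟨I, G, hG⟩ := exists_isPresentableFamily C κ
  have := PresentableCode.small.{w} G X
  let S := {s : Σ (Z : C), (X ⟶ Z) // presentableMor C κ s.2 ∧ ∃ q : s.1 ⟶ B, s.2 ≫ q = p}
  let r (s s' : S) : Prop := ∃ e : s.1.1 ≅ s'.1.1, s.1.2 ≫ e.hom = s'.1.2
  have hr : Equivalence r :=
    { refl s := ⟨Iso.refl _, by simp⟩
      symm := fun ⟨e, h₁⟩ ↦ ⟨e.symm, by simp [← h₁]⟩
      trans := fun ⟨e, h₁⟩ ⟨e', h₁'⟩ ↦ ⟨e ≪≫ e', by simp [reassoc_of% h₁, h₁']⟩ }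
  let pr (s : S) := (hG.nonempty_presentation s.1.2 s.2.1).some
  obtain ⟨ι, f, hf⟩ := exists_skeleton hr (fun s ↦ (pr s).code) (fun s s' h ↦ by
    obtain ⟨e, he, -⟩ := (pr s).exists_iso_of_code_eq (pr s') h
    exact ⟨e, he⟩)
  choose q hq using fun i ↦ (f i).2.2
  obtain ⟨X', g, p', hg, hp'⟩ := exists_isInducedMultiplePushout p (fun i ↦ (f i).1.1)
    (fun i ↦ (f i).1.2) q hq
  exact ⟨X', g, p', hg, ι, _, _, _, fun i ↦ ⟨(f i).2.1, hq i⟩,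
    fun Z h' hh' hq' ↦ hf ⟨⟨Z, h'⟩, hh', hq'⟩, hp'⟩

variable (κ) in
lemma nonempty_strictFactorization {A B : C} (f : A ⟶ B) :
    Nonempty (StrictFactorization κ (presentableMor C κ) f) :=
  nonempty_iteratedFactorization κ exists_isStrictStep f

variable (κ) in
lemma nonempty_looseFactorization {A B : C} (f : A ⟶ B) :
    Nonempty (LooseFactorization κ (presentableMor C κ) f) :=
  nonempty_iteratedFactorization κ exists_isLooseStep f

end

/-! ### Properties of strict and loose factorizations -/

namespace IteratedFactorization

variable {C : Type u} [Category.{v} C] {κ : Cardinal.{w}} [Fact κ.IsRegular]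
  {step : ∀ {B X X' : C}, (X ⟶ B) → (X ⟶ X') → (X' ⟶ B) → Prop} {A B : C} {f : A ⟶ B}

/-- A morphism from a `κ`-presentable object to the middle object factors through the chain. -/
lemma exists_fac (S : IteratedFactorization κ step f) {X : C} [IsCardinalPresentable X κ]
    (s : X ⟶ S.mid) :
    letI := ordOrderBot κ
    ∃ (α : κ.ord.ToType) (s' : X ⟶ S.chain.F.obj α), s' ≫ S.chain.incl.app α = s :=
  letI := ordOrderBot κ
  IsCardinalPresentable.exists_hom_of_isColimit κ (X := X) S.chain.isColimit s

end IteratedFactorization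

section

variable {C : Type u} [Category.{v} C] {κ : Cardinal.{w}} [Fact κ.IsRegular]
  [IsCardinalLocallyPresentable C κ] {A B : C} {f : A ⟶ B}

/-- Lifting against a morphism `z : X ⟶ Y` between `κ`-presentable objects: `X ⟶ S.mid` factors
through a stage `α`, and the cobase change of `z` to that stage, with its induced morphism to `B`,
is isomorphic to one of the factorizations attached at the next stage. -/
lemma isIso_right_of_strictFactorization (S : StrictFactorization κ (presentableMor C κ) f) :
    IsIso S.right := by
  let _ := ordOrderBot κ
  refine isIso_of_lifting (κ := κ) _ (fun X Y hX hY z s t sq ↦ ?_)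
  obtain ⟨α, s', rfl⟩ := S.exists_fac s
  obtain ⟨ι, Y', h, q, -, hex, j, hj, -, hjq⟩ := S.step_mem α
  obtain ⟨i, ⟨e, he₁, he₂⟩, -⟩ := hex (pushout s' z) (pushout.inl s' z)
    (pushout.desc (S.chain.incl.app α ≫ S.right) t (by rw [← sq, Category.assoc]))
    (presentableMor_of_isPushout (IsPushout.of_hasPushout s' z).flip
      (presentableMor_of_isCardinalPresentable z)) (pushout.inl_desc _ _ _)
  have hw : S.chain.F.map (homOfLE (Order.le_succ α)) ≫ S.chain.incl.app (Order.succ α) =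
    S.chain.incl.app α := (S.chain.incl.naturality _).trans (Category.comp_id _)
  refine ⟨pushout.inr s' z ≫ e.inv ≫ j i ≫ S.chain.incl.app (Order.succ α), ?_, ?_⟩
  · rw [← pushout.condition_assoc, ← he₁, Category.assoc, e.hom_inv_id_assoc, reassoc_of% hj i, hw]
  · have := hjq i
    simp only [Category.assoc] at this ⊢
    rw [this, ← he₂, e.inv_hom_id_assoc, pushout.inr_desc]

/-- In contrast with the strict case, the representative of the cobase change of `z` comes with
a chosen morphism to `B` which need not be compatible with `Y ⟶ B`: only the triangle over
`X` commutes. -/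
lemma isPure_right_of_looseFactorization (S : LooseFactorization κ (presentableMor C κ) f) :
    IsPure κ S.right := by
  let _ := ordOrderBot κ
  intro X Y hX hY z s t sq
  obtain ⟨α, s', rfl⟩ := S.exists_fac s
  obtain ⟨ι, Y', h, q, -, hex, j, hj, -, hjq⟩ := S.step_mem α
  obtain ⟨i, ⟨e, he₁⟩, -⟩ := hex (pushout s' z) (pushout.inl s' z)
    (presentableMor_of_isPushout (IsPushout.of_hasPushout s' z).flip
      (presentableMor_of_isCardinalPresentable z))
    ⟨pushout.desc (S.chain.incl.app α ≫ S.right) t (by rw [← sq, Category.assoc]),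
      pushout.inl_desc _ _ _⟩
  have hw : S.chain.F.map (homOfLE (Order.le_succ α)) ≫ S.chain.incl.app (Order.succ α) =
    S.chain.incl.app α := (S.chain.incl.naturality _).trans (Category.comp_id _)
  refine ⟨pushout.inr s' z ≫ e.inv ≫ j i ≫ S.chain.incl.app (Order.succ α), ?_⟩
  rw [← pushout.condition_assoc, ← he₁, Category.assoc, e.hom_inv_id_assoc, reassoc_of% hj i, hw]

end

/-! ### Presentable objects with respect to a larger cardinal -/

section

variable {C : Type u} [Category.{v} C]

section

variable {J : Type w} [PartialOrder J] (D : J ⥤ C) [HasColimitsOfSize.{w, w} C]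

/-- The colimit of the restriction of the diagram `D` to a subset of its indexing poset. -/
noncomputable def partialColim (S : Set J) : C :=
  colimit ((Subtype.mono_coe (· ∈ S)).functor ⋙ D)

/-- The canonical morphisms to a partial colimit. -/
noncomputable def ιPartial (S : Set J) (j : J) (hj : j ∈ S) : D.obj j ⟶ partialColim D S :=
  colimit.ι ((Subtype.mono_coe (· ∈ S)).functor ⋙ D) ⟨j, hj⟩

lemma ιPartial_w (S : Set J) {j j' : J} (hj : j ∈ S) (hj' : j' ∈ S) (φ : j ⟶ j') :
    D.map φ ≫ ιPartial D S j' hj' = ιPartial D S j hj :=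
  colimit.w ((Subtype.mono_coe (· ∈ S)).functor ⋙ D)
    (homOfLE (leOfHom φ) : (⟨j, hj⟩ : S) ⟶ ⟨j', hj'⟩)

lemma ιPartial_w_assoc (S : Set J) {j j' : J} (hj : j ∈ S) (hj' : j' ∈ S) (φ : j ⟶ j') {Z : C}
    (g : partialColim D S ⟶ Z) :
    D.map φ ≫ ιPartial D S j' hj' ≫ g = ιPartial D S j hj ≫ g := by
  rw [← Category.assoc, ιPartial_w D S hj hj' φ]

variable {D}

lemma partialColim_hom_ext {S : Set J} {Z : C} {f g : partialColim D S ⟶ Z}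
    (h : ∀ j hj, ιPartial D S j hj ≫ f = ιPartial D S j hj ≫ g) : f = g :=
  colimit.hom_ext (fun j ↦ h j.1 j.2)

/-- The universal property of a partial colimit. -/
noncomputable def descPartial {S : Set J} {Z : C} (f : ∀ j ∈ S, D.obj j ⟶ Z)
    (hf : ∀ ⦃j j' : J⦄ (hj : j ∈ S) (hj' : j' ∈ S) (φ : j ⟶ j'), D.map φ ≫ f j' hj' = f j hj) :
    partialColim D S ⟶ Z :=
  colimit.desc ((Subtype.mono_coe (· ∈ S)).functor ⋙ D) (Cocone.mk Z
    { app j := f j.1 j.2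
      naturality _ _ _ := (hf _ _ _).trans (Category.comp_id _).symm })

@[simp]
lemma ι_descPartial {S : Set J} {Z : C} (f : ∀ j ∈ S, D.obj j ⟶ Z)
    (hf : ∀ ⦃j j' : J⦄ (hj : j ∈ S) (hj' : j' ∈ S) (φ : j ⟶ j'), D.map φ ≫ f j' hj' = f j hj)
    (j : J) (hj : j ∈ S) : ιPartial D S j hj ≫ descPartial f hf = f j hj :=
  colimit.ι_desc _ _

@[simp]
lemma ι_descPartial_assoc {S : Set J} {Z Z' : C} (f : ∀ j ∈ S, D.obj j ⟶ Z)
    (hf : ∀ ⦃j j' : J⦄ (hj : j ∈ S) (hj' : j' ∈ S) (φ : j ⟶ j'), D.map φ ≫ f j' hj' = f j hj)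
    (j : J) (hj : j ∈ S) (g : Z ⟶ Z') :
    ιPartial D S j hj ≫ descPartial f hf ≫ g = f j hj ≫ g := by
  rw [← Category.assoc, ι_descPartial]

variable (D) in
/-- The functor which sends a set `S` of indices in the family `T` to the colimit of the
restriction of the diagram `D` to `S`. -/
@[simps]
noncomputable def partialColimFunctor (T : Set (Set J)) : T ⥤ C where
  obj S := partialColim D S.1
  map {S S'} φ := descPartial (fun j hj ↦ ιPartial D S'.1 j (leOfHom φ hj))
    (fun _ _ _ _ _ ↦ ιPartial_w _ _ _ _ _)
  map_id S := partialColim_hom_ext (by simp)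
  map_comp φ ψ := partialColim_hom_ext (by simp)

/-- The morphism from a partial colimit to the point of a cocone. -/
noncomputable def partialColimDesc (c : Cocone D) (S : Set J) : partialColim D S ⟶ c.pt :=
  descPartial (fun j _ ↦ c.ι.app j) (fun _ _ _ _ φ ↦ c.w φ)

@[simp]
lemma ι_partialColimDesc (c : Cocone D) (S : Set J) (j : J) (hj : j ∈ S) :
    ιPartial D S j hj ≫ partialColimDesc c S = c.ι.app j :=
  ι_descPartial _ _ _ _

@[simp]
lemma ι_partialColimDesc_assoc (c : Cocone D) (S : Set J) (j : J) (hj : j ∈ S) {Z : C}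
    (g : c.pt ⟶ Z) :
    ιPartial D S j hj ≫ partialColimDesc c S ≫ g = c.ι.app j ≫ g := by
  rw [← Category.assoc, ι_partialColimDesc]

/-- The cocone with the same point on the partial colimits of a diagram. -/
@[simps]
noncomputable def partialColimCocone (c : Cocone D) (T : Set (Set J)) :
    Cocone (partialColimFunctor D T) where
  pt := c.pt
  ι :=
    { app S := partialColimDesc c S.1
      naturality S S' φ := by
        have h : descPartial (fun j hj ↦ ιPartial D S'.1 j (leOfHom φ hj))
            (fun _ _ _ _ _ ↦ ιPartial_w _ _ _ _ _) ≫ partialColimDesc c S'.1 =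
              partialColimDesc c S.1 :=
          partialColim_hom_ext (by simp)
        exact h.trans (Category.comp_id _).symm }

/-- If every pair of indices belongs to a member of the directed family `T`, then the colimit
of a diagram is the colimit of the partial colimits for the members of `T`. -/
lemma nonempty_isColimit_partialColimCocone {c : Cocone D} (hc : IsColimit c) (T : Set (Set J))
    [IsDirectedOrder T] (hT : ∀ j j' : J, ∃ S ∈ T, j ∈ S ∧ j' ∈ S) :
    Nonempty (IsColimit (partialColimCocone c T)) := by
  refine ⟨IsColimit.ofExistsUnique (fun s ↦ ?_)⟩
  obtain ⟨σ, hσ⟩ : ∃ σ : ∀ (S : T), partialColim D S.1 ⟶ s.pt,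
    ∀ S, σ S = s.ι.app S := ⟨fun S ↦ s.ι.app S, fun _ ↦ rfl⟩
  have hσ' {S S' : T} (h : S ≤ S') (j : J) (hj : j ∈ S.1) :
      ιPartial D S'.1 j (h hj) ≫ σ S' = ιPartial D S.1 j hj ≫ σ S := by
    rw [hσ S, ← s.w (homOfLE h), ← hσ]
    exact (ι_descPartial_assoc (fun j hj ↦ ιPartial D S'.1 j (h hj))
      (fun _ _ _ _ φ ↦ ιPartial_w _ _ _ _ φ) j hj (σ S')).symm
  have hσ'' (S S' : T) (j : J) (hj : j ∈ S.1) (hj' : j ∈ S'.1) :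
      ιPartial D S'.1 j hj' ≫ σ S' = ιPartial D S.1 j hj ≫ σ S := by
    obtain ⟨S'', h, h'⟩ := exists_ge_ge S S'
    rw [← hσ' h j hj, ← hσ' h' j hj']
  choose S hS h₁ h₂ using fun j ↦ hT j j
  obtain ⟨t, ht⟩ : ∃ t : c.pt ⟶ s.pt, ∀ j,
      c.ι.app j ≫ t = ιPartial D (S j) j (h₁ j) ≫ σ ⟨S j, hS j⟩ := by
    let t : Cocone D :=
      { pt := s.pt
        ι :=
          { app j := ιPartial D (S j) j (h₁ j) ≫ σ ⟨S j, hS j⟩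
            naturality j j' φ := by
              refine Eq.trans ?_ (Category.comp_id _).symm
              obtain ⟨S', hS', hj, hj'⟩ := hT j j'
              rw [hσ'' ⟨S', hS'⟩ ⟨S j, hS j⟩ j hj, hσ'' ⟨S', hS'⟩ ⟨S j', hS j'⟩ j' hj',
                ιPartial_w_assoc] } }
    exact ⟨hc.desc t, hc.fac t⟩
  refine ⟨t, fun S' ↦ ?_, fun m hm ↦ ?_⟩
  · rw [← hσ]
    refine partialColim_hom_ext (fun j hj ↦ ?_)
    exact (ι_partialColimDesc_assoc _ _ _ _ _).trans
      ((ht j).trans (hσ'' S' ⟨S j, hS j⟩ j hj (h₁ j)))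
  · change c.pt ⟶ s.pt at m
    have hm (S : T) : partialColimDesc c S.1 ≫ m = σ S := (hm S).trans (hσ S).symm
    refine hc.hom_ext (fun j ↦ ?_)
    rw [ht, ← hm, ι_partialColimDesc_assoc]

end

end

/-! ### Dense families -/

/-- Every type of cardinality `< κ'` has a cofinal set, of cardinality `< κ'`, of subsets of
cardinality `< κ`. For `κ < κ'` this is one of the forms of `κ ◁ κ'`. -/
def HasSmallCofinalSubsets (κ κ' : Cardinal.{w}) : Prop :=
  ∀ (X : Type w) (_ : HasCardinalLT X κ'),
    ∃ (Y : Set (CardinalDirectedPoset.SetCardinalLT κ X)), HasCardinalLT Y κ' ∧ IsCofinal Y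

lemma hasSmallCofinalSubsets_of_sharplyLT {κ κ' : Cardinal.{w}} [Fact κ.IsRegular]
    [Fact κ'.IsRegular] (h : Cardinal.SharplyLT κ κ') : HasSmallCofinalSubsets κ κ' := by
  have := h.isCardinalAccessible_cardinalDirectedPoset
  intro X hX
  exact Cardinal.SharplyLT.exists_cofinal_of_isCardinalAccessibleCategory_cardinalDirectedPoset
    h.le hX

/-- If `κ ≤ μ`, then `κ ◁ (2 ^ μ)⁺`. -/
lemma hasSmallCofinalSubsets_succ_two_power {κ μ : Cardinal.{w}} (h : κ ≤ μ)
    (hμ : Cardinal.aleph0 ≤ μ) :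
    HasSmallCofinalSubsets κ (Order.succ (2 ^ μ)) := by
  intro X hX
  rw [hasCardinalLT_iff_cardinal_mk_lt, Order.lt_succ_iff] at hX
  refine ⟨Set.univ, ?_, fun x ↦ ⟨x, Set.mem_univ _, le_rfl⟩⟩
  refine HasCardinalLT.of_injective (X := {t : Set X // Cardinal.mk t ≤ μ}) ?_
    (fun t ↦ ⟨t.1.1, ((hasCardinalLT_iff_cardinal_mk_lt _ _).1 t.1.2).le.trans h⟩)
    (fun t t' htt' ↦ Subtype.ext (Subtype.ext (Subtype.ext_iff.1 htt' :)))
  rw [hasCardinalLT_iff_cardinal_mk_lt, Order.lt_succ_iff]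
  refine (Cardinal.mk_bounded_set_le X μ).trans ?_
  refine (Cardinal.power_le_power_right (c := μ) (max_le hX
    (hμ.trans (Cardinal.cantor μ).le))).trans ?_
  rw [← Cardinal.power_mul, Cardinal.mul_eq_self hμ]

section

variable {C : Type u} [Category.{v} C]

/-- A family of morphisms `c s : D s ⟶ X` from `κ`-presentable objects is dense if all
morphisms from `κ`-presentable objects to `X` factor through it, and if `X` is the
colimit of the objects `D s` with respect to all the morphisms `D s ⟶ D s'` over `X`. -/
structure IsDenseFamily (κ : Cardinal.{w}) [Fact κ.IsRegular] {X : C} {S : Type w} {D : S → C}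
    (c : ∀ s, D s ⟶ X) : Prop where
  isCardinalPresentable (s : S) : IsCardinalPresentable (D s) κ
  exists_fac (G : C) (hG : IsCardinalPresentable G κ) (g : G ⟶ X) :
    ∃ (s : S) (f : G ⟶ D s), f ≫ c s = g
  existsUnique (T : C) (t : ∀ s, D s ⟶ T)
    (ht : ∀ (s s' : S) (f : D s ⟶ D s'), f ≫ c s' = c s → f ≫ t s' = t s) :
    ∃! d : X ⟶ T, ∀ s, c s ≫ d = t s

namespace IsDenseFamily

variable {κ : Cardinal.{w}} [Fact κ.IsRegular] {X : C} {S : Type w} {D : S → C} {c : ∀ s, D s ⟶ X}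

/-- A family with the same members up to isomorphism as a dense family is dense. -/
lemma of_iso (hc : IsDenseFamily κ c) {S' : Type w} {D' : S' → C} (c' : ∀ s, D' s ⟶ X)
    (h : ∀ s, ∃ (s' : S') (e : D s ≅ D' s'), e.hom ≫ c' s' = c s)
    (h' : ∀ s', ∃ (s : S) (e : D s ≅ D' s'), e.hom ≫ c' s' = c s) : IsDenseFamily κ c' where
  isCardinalPresentable s' := by
    obtain ⟨s, e, -⟩ := h' s'
    have := hc.isCardinalPresentable s
    exact isCardinalPresentable_of_iso e κ
  exists_fac G hG g := by
    obtain ⟨s, f, hf⟩ := hc.exists_fac G hG g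
    obtain ⟨s', e, he⟩ := h s
    exact ⟨s', f ≫ e.hom, by rw [Category.assoc, he, hf]⟩
  existsUnique T t ht := by
    choose x e he using h
    have he' (s : S) : (e s).inv ≫ c s = c' (x s) := by simp [← he]
    obtain ⟨d, hd, hd'⟩ := hc.existsUnique T (fun s ↦ (e s).hom ≫ t (x s)) (fun s s' f hf ↦ by
      rw [← ht (x s) (x s') ((e s).inv ≫ f ≫ (e s').hom) (by simp [he, hf, he'])]
      simp)
    refine ⟨d, fun s' ↦ ?_, fun d' hd'' ↦ hd' d' (fun s ↦ ?_)⟩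
    · obtain ⟨s, e', he'₂⟩ := h' s'
      rw [← cancel_epi e'.hom, reassoc_of% he'₂, hd,
        ← ht (x s) s' ((e s).inv ≫ e'.hom) (by simp [he'₂, he'])]
      simp
    · rw [← hd'', reassoc_of% he]

/-- If `X` has a dense family of cardinality `< κ'`, there are `< κ'` morphisms from a
`κ`-presentable object to `X`. -/
lemma hasCardinalLT_hom (hc : IsDenseFamily κ c) {κ' : Cardinal.{w}} [Fact κ'.IsRegular]
    (hS : HasCardinalLT S κ') (G : C) [IsCardinalPresentable G κ]
    (hG : ∀ s, HasCardinalLT (G ⟶ D s) κ') : HasCardinalLT (G ⟶ X) κ' :=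
  (hasCardinalLT_sigma _ _ hS hG).of_surjective
    (fun (x : Σ s, G ⟶ D s) ↦ x.2 ≫ c x.1) (fun g ↦ by
      obtain ⟨s, f, hf⟩ := hc.exists_fac G inferInstance g
      exact ⟨⟨s, f⟩, hf⟩)

lemma hom_ext (hc : IsDenseFamily κ c) {T : C} {f g : X ⟶ T} (h : ∀ s, c s ≫ f = c s ≫ g) :
    f = g :=
  (hc.existsUnique T (fun s ↦ c s ≫ g)
    (fun s s' φ hφ ↦ by rw [reassoc_of% hφ])).unique h (fun _ ↦ rfl)

end IsDenseFamily

variable {κ : Cardinal.{w}} [Fact κ.IsRegular]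

/-- A retract of a `κ`-directed colimit of `κ`-presentable objects has a dense family
indexed by the same poset. -/
lemma isDenseFamily_of_retract [HasColimitsOfSize.{w, w} C] {J : Type w} [PartialOrder J]
    {D : J ⥤ C} (hD : ∀ j, IsCardinalPresentable (D.obj j) κ) (S : Set J)
    [IsCardinalFiltered S κ] {X : C} (i : X ⟶ partialColim D S) (r : partialColim D S ⟶ X)
    (hir : i ≫ r = 𝟙 X) :
    IsDenseFamily κ (fun (j : S) ↦ ιPartial D S j.1 j.2 ≫ r) := by
  have hfac (G : C) (hG : IsCardinalPresentable G κ) (g : G ⟶ partialColim D S) :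
      ∃ (s : S) (f : G ⟶ D.obj s.1), f ≫ ιPartial D S s.1 s.2 = g :=
    IsCardinalPresentable.exists_hom_of_isColimit κ
      (colimit.isColimit ((Subtype.mono_coe (· ∈ S)).functor ⋙ D)) (X := G) g
  refine ⟨fun s ↦ hD _, fun G hG g ↦ ?_, fun T t ht ↦ ?_⟩
  · obtain ⟨s, f, hf⟩ := hfac G hG (g ≫ i)
    exact ⟨s, f, by rw [reassoc_of% hf, hir, Category.comp_id]⟩
  · let t' : partialColim D S ⟶ T := descPartial (fun j hj ↦ t ⟨j, hj⟩) (fun j j' hj hj' φ ↦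
      ht ⟨j, hj⟩ ⟨j', hj'⟩ (D.map φ) (ιPartial_w_assoc _ _ _ _ _ _))
    have ht' (j : J) (hj : j ∈ S) : ιPartial D S j hj ≫ t' = t ⟨j, hj⟩ := ι_descPartial _ _ _ _
    have key (s : S) : (ιPartial D S s.1 s.2 ≫ r) ≫ i ≫ t' = t s := by
      obtain ⟨s', f, hf⟩ := hfac (D.obj s.1) (hD _) (ιPartial D S s.1 s.2 ≫ r ≫ i)
      rw [← ht s s' f (by rw [reassoc_of% hf, hir, Category.comp_id]), Category.assoc,
        ← reassoc_of% hf, ht']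
    refine ⟨i ≫ t', key, fun d hd ↦ ?_⟩
    have : r ≫ d = r ≫ i ≫ t' := partialColim_hom_ext (fun j hj ↦ by
      rw [← Category.assoc, hd ⟨j, hj⟩, ← Category.assoc, key ⟨j, hj⟩])
    simpa [reassoc_of% hir] using i ≫= this

/-- If `κ ◁ κ'`, every `κ'`-presentable object has a dense family of cardinality `< κ'`. -/
lemma exists_isDenseFamily [IsCardinalLocallyPresentable C κ] {κ' : Cardinal.{w}}
    [Fact κ'.IsRegular] (h : κ < κ') (h' : HasSmallCofinalSubsets κ κ') (X : C)
    [IsCardinalPresentable X κ'] :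
    ∃ (S : Type w) (D : S → C) (c : ∀ s, D s ⟶ X), Nonempty S ∧ HasCardinalLT S κ' ∧
      IsDenseFamily κ c := by
  obtain ⟨J₀, _, _, ⟨p⟩⟩ :=
    (isCardinalFilteredGenerator_isCardinalPresentable C κ).exists_colimitsOfShape X
  obtain ⟨J, _, _, F, _⟩ := IsCardinalFiltered.exists_cardinal_directed J₀ κ
  let D := F ⋙ p.diag
  have hD (j : J) : IsCardinalPresentable (D.obj j) κ := p.prop_diag_obj _
  let c : Cocone D := Cocone.whisker F (Cocone.mk X p.ι)
  have hc : IsColimit c := (Functor.Final.isColimitWhiskerEquiv F _).symm p.isColimit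
  let T : Set (Set J) := {S | IsCardinalFiltered S κ ∧ HasCardinalLT S κ'}
  have hT (A : Set J) (hA : HasCardinalLT A κ') : ∃ S ∈ T, A ⊆ S := by
    obtain ⟨S, h₁, h₂, h₃⟩ :=
      Cardinal.SharplyLT.exists_isCardinalFiltered_set_of_exists_cofinal h h' A hA
    exact ⟨S, ⟨h₂, h₃⟩, h₁⟩
  have hκ' : Cardinal.aleph0 ≤ κ' := Cardinal.IsRegular.aleph0_le Fact.out
  have : IsCardinalFiltered T κ' := isCardinalFiltered_preorder _ _ (fun K f hK ↦ by
    rw [← hasCardinalLT_iff_cardinal_mk_lt] at hK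
    obtain ⟨S, hS, hS'⟩ := hT (⋃ k, (f k).1) (hasCardinalLT_iUnion _ hK (fun k ↦ (f k).2.2))
    exact ⟨⟨S, hS⟩, fun k ↦ (Set.subset_iUnion (fun k ↦ (f k).1) k).trans hS'⟩)
  have : IsFiltered T := isFiltered_of_isCardinalFiltered T κ'
  have : IsDirectedOrder T := IsFiltered.isDirectedOrder _
  obtain ⟨hc'⟩ := nonempty_isColimit_partialColimCocone hc T (fun j j' ↦ by
    obtain ⟨S, hS, hS'⟩ := hT {j, j'} (hasCardinalLT_of_finite _ _ hκ')
    exact ⟨S, hS, hS' (by simp), hS' (by simp)⟩)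
  obtain ⟨S, i, hi⟩ : ∃ (S : T) (i : X ⟶ partialColim D S.1), i ≫ partialColimDesc c S.1 = 𝟙 X :=
    IsCardinalPresentable.exists_hom_of_isColimit κ' hc' (X := X) (𝟙 X)
  have := S.2.1
  have := isFiltered_of_isCardinalFiltered S.1 κ
  exact ⟨S.1, _, _, IsFiltered.nonempty, S.2.2, isDenseFamily_of_retract hD S.1 i _ hi⟩

end

/-! ### Counting presentable objects and their morphisms -/

lemma HasCardinalLT.exists_injective {X : Type v} {c : Cardinal.{w}}
    (hX : HasCardinalLT X (Order.succ c)) {Δ : Type w} (hΔ : Cardinal.mk Δ = c) :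
    ∃ f : X → Δ, Function.Injective f := by
  rw [HasCardinalLT, Cardinal.lift_succ, Order.lt_succ_iff, ← hΔ, Cardinal.lift_mk_le'] at hX
  obtain ⟨f⟩ := hX
  exact ⟨f, f.injective⟩

section

variable {C : Type u} [Category.{v} C]

/-- An object is determined up to isomorphism by the sources of a dense family and by
the morphisms between them that are compatible with the family. -/
lemma IsDenseFamily.nonempty_iso {κ : Cardinal.{w}} [Fact κ.IsRegular] {X X' : C} {S : Type w}
    {D : S → C} {c : ∀ s, D s ⟶ X} {c' : ∀ s, D s ⟶ X'} (hc : IsDenseFamily κ c)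
    (hc' : IsDenseFamily κ c')
    (h : ∀ (s s' : S) (f : D s ⟶ D s'), f ≫ c s' = c s ↔ f ≫ c' s' = c' s) :
    Nonempty (X ≅ X') := by
  obtain ⟨d, hd, -⟩ := hc.existsUnique X' c' (fun s s' f ↦ (h s s' f).1)
  obtain ⟨d', hd', -⟩ := hc'.existsUnique X c (fun s s' f ↦ (h s s' f).2)
  exact ⟨d, d', hc.hom_ext (fun s ↦ by rw [reassoc_of% hd, hd', Category.comp_id]),
    hc'.hom_ext (fun s ↦ by rw [reassoc_of% hd', hd, Category.comp_id])⟩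

variable {κ : Cardinal.{w}} [Fact κ.IsRegular]

/-- A dense family can be taken in a given presentable family, and indexed by any type which
is large enough. -/
lemma IsPresentableFamily.exists_isDenseFamily [IsCardinalLocallyPresentable C κ] {I : Type w}
    {G : I → C} (hG : IsPresentableFamily κ G) {c₀ : Cardinal.{w}}
    [Fact (Order.succ c₀).IsRegular] (h : κ ≤ c₀)
    (h' : HasSmallCofinalSubsets κ (Order.succ c₀)) {Δ : Type w} (hΔ : Cardinal.mk Δ = c₀) (X : C)
    [IsCardinalPresentable X (Order.succ c₀)] :
    ∃ (u : Δ → I) (c : ∀ x, G (u x) ⟶ X), IsDenseFamily κ c := by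
  obtain ⟨S, D, c, _, hS, hc⟩ :=
    PresentableMorphisms.exists_isDenseFamily (Order.lt_succ_iff.2 h) h' X
  choose u e using fun s ↦ hG.exists_iso (D s) (hc.isCardinalPresentable s)
  obtain ⟨f, hf⟩ := HasCardinalLT.exists_injective hS hΔ
  have hσ := Function.invFun_surjective hf
  generalize Function.invFun f = σ at hσ
  refine ⟨fun x ↦ u (σ x), fun x ↦ (e (σ x)).some.inv ≫ c (σ x), hc.of_iso _ (fun s ↦ ?_)
    (fun x ↦ ⟨σ x, (e (σ x)).some, by simp⟩)⟩
  obtain ⟨x, rfl⟩ := hσ s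
  exact ⟨x, (e (σ x)).some, by simp⟩

variable [IsCardinalLocallyPresentable C κ] {I : Type w} {G : I → C}
  (hG : IsPresentableFamily κ G) {μ : Cardinal.{w}} (hμ : Cardinal.aleph0 ≤ μ) (hκ : κ ≤ μ)
  (hH : HasCardinalLT (Σ (p : I × I), G p.1 ⟶ G p.2) (Order.succ μ))
  [Fact (Order.succ ((2 : Cardinal.{w}) ^ μ)).IsRegular]

include hG hμ hκ hH

/-- If there are at most `μ` morphisms between `κ`-presentable objects, then there are at most
`2 ^ μ` morphisms from a `κ`-presentable object to a `(2 ^ μ)⁺`-presentable object. -/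
lemma IsPresentableFamily.hasCardinalLT_hom (i : I) (Y : C)
    [IsCardinalPresentable Y (Order.succ ((2 : Cardinal.{w}) ^ μ))] :
    HasCardinalLT (G i ⟶ Y) (Order.succ ((2 : Cardinal.{w}) ^ μ)) := by
  have := hG.isCardinalPresentable i
  have hμ' := Cardinal.cantor μ
  obtain ⟨Δ, hΔ⟩ : ∃ (Δ : Type w), Cardinal.mk Δ = 2 ^ μ := ⟨_, Cardinal.mk_out _⟩
  obtain ⟨u, c, hc⟩ := hG.exists_isDenseFamily (hκ.trans hμ'.le)
    (hasSmallCofinalSubsets_succ_two_power hκ hμ) hΔ Y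
  refine hc.hasCardinalLT_hom ?_ (G i) (fun x ↦ ?_)
  · rw [hasCardinalLT_iff_cardinal_mk_lt, hΔ]
    exact Order.lt_succ _
  · exact (hH.of_le (Order.succ_le_succ hμ'.le)).of_injective
      (fun f ↦ (⟨(i, u x), f⟩ : Σ (p : I × I), G p.1 ⟶ G p.2))
      (fun f f' hff' ↦ by simpa using hff')

/-- If there are at most `μ` morphisms between `κ`-presentable objects, then there are at most
`2 ^ 2 ^ μ` morphisms between two `(2 ^ μ)⁺`-presentable objects. -/
lemma IsPresentableFamily.hasCardinalLT_hom' (X Y : C)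
    [IsCardinalPresentable X (Order.succ ((2 : Cardinal.{w}) ^ μ))]
    [IsCardinalPresentable Y (Order.succ ((2 : Cardinal.{w}) ^ μ))] :
    HasCardinalLT (X ⟶ Y) (Order.succ ((2 : Cardinal.{w}) ^ ((2 : Cardinal.{w}) ^ μ))) := by
  have hμ' := Cardinal.cantor μ
  obtain ⟨Δ, hΔ⟩ : ∃ (Δ : Type w), Cardinal.mk Δ = 2 ^ μ := ⟨_, Cardinal.mk_out _⟩
  obtain ⟨u, c, hc⟩ := hG.exists_isDenseFamily (hκ.trans hμ'.le)
    (hasSmallCofinalSubsets_succ_two_power hκ hμ) hΔ X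
  choose φ hφ using fun x ↦ HasCardinalLT.exists_injective
    (hG.hasCardinalLT_hom hμ hκ hH (u x) Y) hΔ
  refine HasCardinalLT.of_injective (X := Δ → Δ) ?_ (fun g x ↦ φ x (c x ≫ g))
    (fun g g' h ↦ hc.hom_ext (fun x ↦ hφ x (congr_fun h x)))
  rw [hasCardinalLT_iff_cardinal_mk_lt, Order.lt_succ_iff, Cardinal.mk_arrow, hΔ]
  simp only [Cardinal.lift_id]
  rw [← Cardinal.power_mul, Cardinal.mul_eq_right (hμ.trans hμ'.le) hμ'.le
      (Cardinal.aleph0_pos.trans_le hμ).ne']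

/-- If there are at most `μ` morphisms between `κ`-presentable objects, then there are at most
`2 ^ 2 ^ μ` isomorphism classes of `(2 ^ μ)⁺`-presentable objects. -/
lemma IsPresentableFamily.exists_isPresentableFamily :
    ∃ (I' : Type w) (G' : I' → C),
      IsPresentableFamily (Order.succ ((2 : Cardinal.{w}) ^ μ)) G' ∧
      HasCardinalLT I' (Order.succ ((2 : Cardinal.{w}) ^ ((2 : Cardinal.{w}) ^ μ))) := by
  have hμ' := Cardinal.cantor μ
  have := hH.small
  obtain ⟨Δ, hΔ⟩ : ∃ (Δ : Type w), Cardinal.mk Δ = 2 ^ μ := ⟨_, Cardinal.mk_out _⟩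
  let H := Shrink.{w} (Σ (p : I × I), G p.1 ⟶ G p.2)
  let S := {X : C // IsCardinalPresentable X (Order.succ ((2 : Cardinal.{w}) ^ μ))}
  have hS (X : S) : ∃ (u : Δ → I) (c : ∀ x, G (u x) ⟶ X.1), IsDenseFamily κ c := by
    have := X.2
    exact hG.exists_isDenseFamily (hκ.trans hμ'.le)
      (hasSmallCofinalSubsets_succ_two_power hκ hμ) hΔ X.1
  choose u c hc using hS
  let code (X : S) : (Δ → I) × (Δ → Δ → Set H) :=
    ⟨u X, fun x y ↦ {η | ∃ (f : G (u X x) ⟶ G (u X y)), f ≫ c X y = c X x ∧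
      η = equivShrink _ ⟨(_, _), f⟩}⟩
  have hcode (X : S) (x y : Δ) (f : G (u X x) ⟶ G (u X y)) :
      f ≫ c X y = c X x ↔ equivShrink _ ⟨(u X x, u X y), f⟩ ∈ (code X).2 x y := by
    refine ⟨fun hf ↦ ⟨f, hf, rfl⟩, ?_⟩
    rintro ⟨f', hf', h⟩
    simp only [EmbeddingLike.apply_eq_iff_eq, Sigma.mk.injEq, heq_eq_eq, true_and] at h
    rwa [h]
  have hr : Equivalence (fun (X X' : S) ↦ Nonempty (X.1 ≅ X'.1)) :=
    { refl X := ⟨Iso.refl _⟩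
      symm := fun ⟨e⟩ ↦ ⟨e.symm⟩
      trans := fun ⟨e⟩ ⟨e'⟩ ↦ ⟨e ≪≫ e'⟩ }
  have hcode' (X X' : S) (h : code X = code X') : Nonempty (X.1 ≅ X'.1) := by
    have h₁ := hc X
    have h₂ := hc X'
    have h₃ := hcode X
    have h₄ := hcode X'
    rw [← h] at h₄
    have h₅ : u X = u X' := congr_arg Prod.fst h
    generalize c X = cX at h₁ h₃
    generalize c X' = cX' at h₂ h₄
    generalize code X = k at h₃ h₄
    generalize u X = uX at *
    subst h₅
    exact h₁.nonempty_iso h₂ (fun x y f ↦ (h₃ x y f).trans (h₄ x y f).symm)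
  obtain ⟨ι, f, hf⟩ := exists_skeleton.{w} hr code hcode'
  refine ⟨ι, fun i ↦ (f i).1, ⟨fun i ↦ (f i).2, fun X hX ↦ ?_⟩,
    HasCardinalLT.of_injective (X := (Δ → I) × (Δ → Δ → Set H)) ?_ (code ∘ f)
      (fun i j hij ↦ (hf (f j)).unique (hcode' _ _ hij) (hcode' _ _ rfl))⟩
  · obtain ⟨i, ⟨e⟩, -⟩ := hf ⟨X, hX⟩
    exact ⟨i, ⟨e.symm⟩⟩
  · have hI : Cardinal.mk I ≤ μ := by
      rw [← Order.lt_succ_iff, ← hasCardinalLT_iff_cardinal_mk_lt]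
      exact hH.of_injective (fun i ↦ ⟨(i, i), 𝟙 _⟩) (fun i j hij ↦ by
        simp only [Sigma.mk.injEq, Prod.mk.injEq] at hij
        exact hij.1.1)
    have hH' : Cardinal.mk H ≤ μ := by
      rw [← Order.lt_succ_iff, ← hasCardinalLT_iff_cardinal_mk_lt]
      exact hH.of_injective _ (equivShrink _).symm.injective
    have hδ : Cardinal.aleph0 ≤ (2 : Cardinal.{w}) ^ μ := hμ.trans hμ'.le
    rw [hasCardinalLT_iff_cardinal_mk_lt, Order.lt_succ_iff]
    simp only [Cardinal.mk_prod, Cardinal.mk_arrow, Cardinal.lift_id, Cardinal.mk_set, hΔ]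
    refine (mul_le_mul' (Cardinal.power_le_power_right hI) (Cardinal.power_le_power_right
      (Cardinal.power_le_power_right (Cardinal.power_le_power_left two_ne_zero hH')))).trans ?_
    rw [← Cardinal.power_mul, Cardinal.mul_eq_self hδ]
    refine (mul_le_mul' (Cardinal.power_le_power_right hμ'.le) le_rfl).trans ?_
    rw [← Cardinal.power_mul, Cardinal.mul_eq_right hδ hμ'.le (Cardinal.aleph0_pos.trans_le hμ).ne',
      Cardinal.mul_eq_self (hδ.trans (Cardinal.cantor _).le)]

end

/-! ### Presentability of the middle object of a loose factorization -/

section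

lemma hasCardinalLT_arrow_of_isThin {J : Type w} [SmallCategory J] [Quiver.IsThin J]
    {β : Cardinal.{w}} (hβ : Cardinal.aleph0 ≤ β) (hJ : HasCardinalLT J β) :
    HasCardinalLT (Arrow J) β :=
  (hasCardinalLT_prod hβ hJ hJ).of_injective (fun φ ↦ (φ.left, φ.right)) (by
    rintro ⟨i, j, f⟩ ⟨i', j', f'⟩ h
    simp only [Prod.mk.injEq] at h
    obtain ⟨h₁, h₂⟩ := h
    change i = i' at h₁
    change j = j' at h₂
    subst h₁ h₂
    obtain rfl : f = f' := Subsingleton.elim _ _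
    rfl)

variable {C : Type u} [Category.{v} C]

lemma isCardinalPresentable_pushout [HasPushouts C] [LocallySmall.{w} C] (β : Cardinal.{w})
    [Fact β.IsRegular] {X Y Z : C} (f : X ⟶ Y) (g : X ⟶ Z) [IsCardinalPresentable X β]
    [IsCardinalPresentable Y β] [IsCardinalPresentable Z β] :
    IsCardinalPresentable (pushout f g) β := by
  have (k : WalkingSpan) : IsCardinalPresentable ((span f g).obj k) β := by
    obtain _ | _ | _ := k <;> assumption
  exact isCardinalPresentable_of_isColimit _ (colimit.isColimit (span f g)) β
    (hasCardinalLT_of_finite _ _ (Cardinal.IsRegular.aleph0_le Fact.out))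

section

variable [HasPushouts C] [LocallySmall.{w} C] {I : Type w} {G : I → C} {β : Cardinal.{w}}
  [Fact β.IsRegular]

/-- If there are `< β` codomains and morphisms from the family `G` to `β`-presentable objects,
there are `< β` codes over a `β`-presentable object. -/
lemma PresentableCode.hasCardinalLT (hG : ∀ i, IsCardinalPresentable (G i) β)
    (hI : HasCardinalLT I β)
    (hhom : ∀ (i : I) (Y : C), IsCardinalPresentable Y β → HasCardinalLT (G i ⟶ Y) β) (A : C)
    [IsCardinalPresentable A β] : HasCardinalLT (PresentableCode G A) β := by
  have hβ : Cardinal.aleph0 ≤ β := Cardinal.IsRegular.aleph0_le Fact.out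
  refine HasCardinalLT.of_injective (X := Σ (p : I × I), Σ (q : (G p.1 ⟶ G p.2) × (G p.1 ⟶ A)),
    (G p.2 ⟶ pushout q.2 q.1)) ?_ (fun c ↦ ⟨(c.src, c.tgt), (c.z, c.a), c.e⟩)
    PresentableCode.injective
  refine hasCardinalLT_sigma _ _ (hasCardinalLT_prod hβ hI hI) (fun p ↦
    hasCardinalLT_sigma _ _ (hasCardinalLT_prod hβ (hhom _ _ (hG _)) (hhom _ _ inferInstance))
      (fun q ↦ hhom _ _ (isCardinalPresentable_pushout _ _ _)))

end

section

variable {γ β : Cardinal.{w}} [Fact γ.IsRegular] [Fact β.IsRegular]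
  [IsCardinalLocallyPresentable C γ] {I : Type w} {G : I → C} (hG : IsPresentableFamily γ G)
  (hγβ : γ ≤ β) (hI : HasCardinalLT I β)
  (hhom : ∀ (i : I) (Y : C), IsCardinalPresentable Y β → HasCardinalLT (G i ⟶ Y) β)

include hG hγβ hI hhom

lemma isCardinalPresentable_of_isLooseStep {B X X' : C} {p : X ⟶ B} {g : X ⟶ X'} {p' : X' ⟶ B}
    (h : IsLooseStep.{w} (presentableMor C γ) p g p') [IsCardinalPresentable X β] :
    IsCardinalPresentable X' β := by
  have hβ : Cardinal.aleph0 ≤ β := Cardinal.IsRegular.aleph0_le Fact.out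
  have hGβ (i : I) : IsCardinalPresentable (G i) β :=
    have := hG.isCardinalPresentable i
    isCardinalPresentable_of_le _ hγβ
  obtain ⟨ι, Y, h, q, hN, hex, j, hj, ⟨hc⟩, -⟩ := h
  let pr (i : ι) := (hG.nonempty_presentation (h i) (hN i).1).some
  have hι : HasCardinalLT ι β := by
    refine (PresentableCode.hasCardinalLT hGβ hI hhom X).of_injective (fun i ↦ (pr i).code)
      (fun i i' hii' ↦ ?_)
    obtain ⟨e, he, -⟩ := (pr i).exists_iso_of_code_eq (pr i') hii'
    exact (hex (Y i') (h i') (hN i').1 ⟨q i', (hN i').2⟩).unique ⟨e, he⟩ ⟨Iso.refl _, by simp⟩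
  have (k : WidePushoutShape ι) :
      IsCardinalPresentable ((WidePushoutShape.wideSpan X Y h).obj k) β := by
    obtain _ | i := k
    · assumption
    · have := isCardinalPresentable_pushout β (pr i).a (pr i).z
      exact Retract.isCardinalPresentable
        (⟨(pr i).i, (pr i).r, (pr i).i_r⟩ : Retract (Y i) (pushout (pr i).a (pr i).z)) β
  exact isCardinalPresentable_of_isColimit _ hc β (hasCardinalLT_arrow_of_isThin hβ
    ((hasCardinalLT_option_iff _ _ hβ).2 hι))

/-- If all the sizes involved are smaller than `β`, then a loose `γ`-factorization of a
morphism with `β`-presentable domain has a `β`-presentable middle object. -/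
lemma isCardinalPresentable_mid (hγβ' : γ < β) {A B : C} {f : A ⟶ B}
    (L : LooseFactorization γ (presentableMor C γ) f) [hA : IsCardinalPresentable A β] :
    IsCardinalPresentable L.mid β := by
  let _ := ordOrderBot γ
  have hβ : Cardinal.aleph0 ≤ β := Cardinal.IsRegular.aleph0_le Fact.out
  have hJ : HasCardinalLT γ.ord.ToType β := by simpa [hasCardinalLT_iff_cardinal_mk_lt]
  have (α : γ.ord.ToType) : IsCardinalPresentable (L.chain.F.obj α) β := by
    induction α using SuccOrder.limitRecOn with
    | isMin α hα =>
      obtain rfl := hα.eq_bot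
      exact isCardinalPresentable_of_iso L.chain.isoBot.symm β
    | succ α hα hα' => exact isCardinalPresentable_of_isLooseStep hG hγβ hI hhom (L.step_mem α)
    | isSuccLimit α hα hα' =>
      have (k : Set.Iio α) : IsCardinalPresentable
          (((Set.principalSegIio α).monotone.functor ⋙ L.chain.F).obj k) β := hα' _ k.2
      exact isCardinalPresentable_of_isColimit _
        (L.chain.F.isColimitOfIsWellOrderContinuous α hα) β
        (hasCardinalLT_arrow_of_isThin hβ (hJ.of_injective _ Subtype.val_injective))
  exact isCardinalPresentable_of_isColimit _ L.chain.isColimit β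
    (hasCardinalLT_arrow_of_isThin hβ hJ)

end

/-- If `γ ◁ β`, it suffices to bound the morphisms between `γ`-presentable objects. -/
lemma isCardinalPresentable_mid_of_hasSmallCofinalSubsets {γ β : Cardinal.{w}} [Fact γ.IsRegular]
    [Fact β.IsRegular] [IsCardinalLocallyPresentable C γ] {I : Type w} {G : I → C}
    (hG : IsPresentableFamily γ G) (hγβ : γ < β) (hcof : HasSmallCofinalSubsets γ β)
    (hI : HasCardinalLT I β) (hhom : ∀ (i : I) (Y : C), IsCardinalPresentable Y γ →
      HasCardinalLT (G i ⟶ Y) β) {A B : C} {f : A ⟶ B}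
    (L : LooseFactorization γ (presentableMor C γ) f) [IsCardinalPresentable A β] :
    IsCardinalPresentable L.mid β := by
  refine isCardinalPresentable_mid hG hγβ.le hI (fun i Y hY ↦ ?_) hγβ L
  obtain ⟨S, D, c, _, hS, hc⟩ := exists_isDenseFamily hγβ hcof Y
  have := hG.isCardinalPresentable i
  exact hc.hasCardinalLT_hom hS (G i) (fun s ↦ hhom i (D s) (hc.isCardinalPresentable s))

/-- The cardinal `μ` bounds the number of isomorphism classes of `κ`-presentable objects
and of morphisms between them. -/
lemma exists_bound (C : Type u) [Category.{v} C] (κ μ₀ : Cardinal.{w}) [Fact κ.IsRegular]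
    [IsCardinalLocallyPresentable C κ] :
    ∃ (I : Type w) (G : I → C) (μ : Cardinal.{w}), IsPresentableFamily κ G ∧ κ ≤ μ ∧ μ₀ ≤ μ ∧
      Cardinal.aleph0 ≤ μ ∧
      HasCardinalLT (Σ (p : I × I), G p.1 ⟶ G p.2) (Order.succ μ) := by
  obtain ⟨I, G, hG⟩ := exists_isPresentableFamily C κ
  let H := Shrink.{w} (Σ (p : I × I), G p.1 ⟶ G p.2)
  refine ⟨I, G, max (max κ μ₀) (max Cardinal.aleph0 (Cardinal.mk H)), hG,
    (le_max_left _ _).trans (le_max_left _ _), (le_max_right _ _).trans (le_max_left _ _),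
    (le_max_left _ _).trans (le_max_right _ _), ?_⟩
  refine (hasCardinalLT_iff_of_equiv (equivShrink _) _).2 ?_
  rw [hasCardinalLT_iff_cardinal_mk_lt, Order.lt_succ_iff]
  exact (le_max_right _ _).trans (le_max_right _ _)

lemma fact_isRegular_succ_two_power {μ : Cardinal.{w}} (hμ : Cardinal.aleph0 ≤ μ) :
    Fact (Order.succ ((2 : Cardinal.{w}) ^ μ)).IsRegular :=
  ⟨Cardinal.isRegular_succ (hμ.trans (Cardinal.cantor μ).le)⟩

/-- The control of presentability in loose `γ`-factorizations, for a suitable `γ`. -/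
lemma exists_looseFactorization_bound (C : Type u) [Category.{v} C] (κ : Cardinal.{w})
    [Fact κ.IsRegular] [IsCardinalLocallyPresentable C κ] :
    ∃ (γ : Cardinal.{w}) (_ : Fact γ.IsRegular), κ ≤ γ ∧
      ∀ (β : Cardinal.{w}) [Fact β.IsRegular], Cardinal.SharplyLT γ β →
        Order.succ (Cardinal.powerlt γ γ) < β →
        ∀ ⦃A B : C⦄ (f : A ⟶ B), IsCardinalPresentable A β →
          ∀ L : LooseFactorization γ (presentableMor C γ) f, IsCardinalPresentable L.mid β := by
  obtain ⟨I, G, μ, hG, hκμ, -, hμ, hH⟩ := exists_bound C κ κ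
  have hγ := fact_isRegular_succ_two_power hμ
  have hκγ : κ ≤ Order.succ ((2 : Cardinal.{w}) ^ μ) :=
    hκμ.trans ((Cardinal.cantor μ).le.trans (Order.le_succ _))
  have : IsCardinalLocallyPresentable C (Order.succ ((2 : Cardinal.{w}) ^ μ)) := .of_le C hκγ
  obtain ⟨I', G', hG', hI'⟩ := hG.exists_isPresentableFamily hμ hκμ hH
  refine ⟨_, hγ, hκγ, fun β _ hβ hβ' A B f hA L ↦ ?_⟩
  have h : Order.succ ((2 : Cardinal.{w}) ^ ((2 : Cardinal.{w}) ^ μ)) ≤ β := by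
    refine (Order.succ_le_succ ?_).trans hβ'.le
    refine (Cardinal.power_le_power_right (b := Order.succ ((2 : Cardinal.{w}) ^ μ)) ?_).trans
      (Cardinal.le_powerlt _ (Order.lt_succ _))
    exact (Cardinal.ofNat_lt_aleph0 (n := 2)).le.trans
      (hμ.trans ((Cardinal.cantor μ).le.trans (Order.le_succ _)))
  refine isCardinalPresentable_mid_of_hasSmallCofinalSubsets hG' hβ.lt
    (hasSmallCofinalSubsets_of_sharplyLT hβ) (hI'.of_le h) (fun i Y hY ↦ ?_) L
  have := hG'.isCardinalPresentable i
  exact (hG.hasCardinalLT_hom' hμ hκμ hH (G' i) Y).of_le h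

/-- There are sufficiently many `κ`-pure subobjects. -/
lemma exists_pure_factorization (C : Type u) [Category.{v} C] (κ : Cardinal.{w})
    [Fact κ.IsRegular] [IsCardinalLocallyPresentable C κ] (μ₀ : Cardinal.{w}) :
    ∃ (β : Cardinal.{w}) (_ : Fact β.IsRegular), μ₀ ≤ β ∧
      ∀ ⦃A B : C⦄ (f : A ⟶ B), IsCardinalPresentable A β →
        ∃ (A' : C) (i : A ⟶ A') (p : A' ⟶ B), i ≫ p = f ∧
          IsCardinalPresentable A' β ∧ IsPure κ p ∧ Mono p := by
  obtain ⟨I, G, μ, hG, hκμ, hμ₀, hμ, hH⟩ := exists_bound C κ μ₀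
  have := fact_isRegular_succ_two_power hμ
  have hlt : μ < Order.succ ((2 : Cardinal.{w}) ^ μ) := (Cardinal.cantor μ).trans (Order.lt_succ _)
  refine ⟨_, this, hμ₀.trans hlt.le, fun A B f hA ↦ ?_⟩
  obtain ⟨L⟩ := nonempty_looseFactorization κ f
  have hL := isPure_right_of_looseFactorization L
  refine ⟨L.mid, L.left, L.right, L.fac, isCardinalPresentable_mid hG (hκμ.trans hlt.le) ?_
    (fun i Y hY ↦ hG.hasCardinalLT_hom hμ hκμ hH i Y) (hκμ.trans_lt hlt) L, hL, hL.mono⟩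
  exact (hH.of_le (Order.succ_le_of_lt hlt)).of_injective (fun i ↦ ⟨(i, i), 𝟙 _⟩)
    (fun i j hij ↦ by
      simp only [Sigma.mk.injEq, Prod.mk.injEq] at hij
      exact hij.1.1)

end

/-! ### The trivial weak factorization system -/

section

variable {C : Type u} [Category.{v} C]

lemma presentableClosure_presentableMor (κ : Cardinal.{w}) [Fact κ.IsRegular] :
    presentableClosure κ (presentableMor C κ) = presentableMor C κ :=
  le_antisymm inf_le_left (le_inf le_rfl (fun _ _ n hn _ hK ↦ hK n hn))

lemma underRetracts_transfiniteCompositions_presentableMor (κ : Cardinal.{w}) [Fact κ.IsRegular]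
    [IsCardinalLocallyPresentable C κ] :
    underRetracts (MorphismProperty.transfiniteCompositions.{w} (presentableMor C κ)) = ⊤ := by
  rw [eq_top_iff]
  intro A B f _
  exact ⟨B, f, transfiniteCompositions_presentableMor κ f, ⟨Retract.refl _⟩⟩

lemma hasFunctorialFactorization_top_isomorphisms :
    MorphismProperty.HasFunctorialFactorization (⊤ : MorphismProperty C)
      (MorphismProperty.isomorphisms C) :=
  ⟨⟨{ Z := Arrow.rightFunc
      i := Arrow.leftToRight
      p := 𝟙 _
      fac := Category.comp_id _
      hi _ := MorphismProperty.top_apply _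
      hp f := inferInstanceAs (IsIso (𝟙 f.right)) }⟩⟩

lemma isWeakFactorizationSystem_top_isomorphisms :
    MorphismProperty.IsWeakFactorizationSystem (⊤ : MorphismProperty C)
      (MorphismProperty.isomorphisms C) :=
  have := hasFunctorialFactorization_top_isomorphisms (C := C)
  have : (⊤ : MorphismProperty C).IsStableUnderRetracts :=
    ⟨fun _ _ ↦ MorphismProperty.top_apply _⟩
  MorphismProperty.IsWeakFactorizationSystem.mk' _ _ (fun _ p _ hp ↦
    have : IsIso p := hp
    inferInstance)

end

end PresentableMorphisms

open PresentableMorphisms in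
theorem mainTheorem7 {C : Type u} [Category.{v} C] (κ : Cardinal.{w}) [Fact κ.IsRegular]
    [IsCardinalLocallyPresentable C κ] :
    -- the weak factorization system attached to the class of all `κ`-presentable morphisms
    presentableClosure κ (presentableMor C κ) = presentableMor C κ ∧
    (∀ K : C, injectives (presentableMor C κ) K ↔ Nonempty (IsTerminal K)) ∧
    underRetracts (MorphismProperty.transfiniteCompositions.{w}
      (presentableClosure κ (presentableMor C κ))) = ⊤ ∧
    (presentableClosure κ (presentableMor C κ)).rlp = MorphismProperty.isomorphisms C ∧
    MorphismProperty.IsWeakFactorizationSystem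
      (underRetracts (MorphismProperty.transfiniteCompositions.{w}
        (presentableClosure κ (presentableMor C κ))))
      (presentableClosure κ (presentableMor C κ)).rlp ∧
    MorphismProperty.HasFunctorialFactorization
      (underRetracts (MorphismProperty.transfiniteCompositions.{w}
        (presentableClosure κ (presentableMor C κ))))
      (presentableClosure κ (presentableMor C κ)).rlp ∧
    -- every morphism is a transfinite composition of `κ`-presentable morphisms
    (∀ ⦃A B : C⦄ (f : A ⟶ B),
      MorphismProperty.transfiniteCompositions.{w} (presentableMor C κ) f) ∧
    -- the strict factorization
    (∀ ⦃A B : C⦄ (f : A ⟶ B),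
      Nonempty (StrictFactorization κ (presentableMor C κ) f) ∧
      ∀ S : StrictFactorization κ (presentableMor C κ) f,
        MorphismProperty.transfiniteCompositions.{w} (presentableMor C κ) S.left ∧
        (presentableMor C κ).rlp S.right ∧ IsIso S.right) ∧
    -- `κ`-pure morphisms
    (∀ ⦃A B : C⦄ (f : A ⟶ B),
      (IsPure κ f ↔ ∀ ⦃X Y : C⦄ (z : X ⟶ Y) (s : X ⟶ A) (t : Y ⟶ B),
        presentableMor C κ z → s ≫ f = z ≫ t → ∃ d : Y ⟶ A, z ≫ d = s) ∧
      (IsPure κ f → Mono f)) ∧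
    -- the loose factorization
    (∀ ⦃A B : C⦄ (f : A ⟶ B),
      Nonempty (LooseFactorization κ (presentableMor C κ) f) ∧
      ∀ L : LooseFactorization κ (presentableMor C κ) f,
        MorphismProperty.transfiniteCompositions.{w} (presentableMor C κ) L.left ∧
        IsPure κ L.right ∧ Mono L.right) ∧
    -- control of the presentability in the loose factorization
    (∃ (γ : Cardinal.{w}) (_ : Fact γ.IsRegular), κ ≤ γ ∧
      (∀ ⦃A B : C⦄ (f : A ⟶ B), Nonempty (LooseFactorization γ (presentableMor C γ) f)) ∧
      ∀ (β : Cardinal.{w}) [Fact β.IsRegular], Cardinal.SharplyLT γ β →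
        Order.succ (Cardinal.powerlt γ γ) < β →
        ∀ ⦃A B : C⦄ (f : A ⟶ B), IsCardinalPresentable A β →
          ∀ L : LooseFactorization γ (presentableMor C γ) f,
            IsCardinalPresentable L.mid β ∧ IsPure γ L.right ∧ IsPure κ L.right ∧
              Mono L.right) ∧
    -- there are sufficiently many `κ`-pure subobjects
    (∀ μ : Cardinal.{w}, ∃ (β : Cardinal.{w}) (_ : Fact β.IsRegular), μ ≤ β ∧
      ∀ ⦃A B : C⦄ (f : A ⟶ B), IsCardinalPresentable A β →
        ∃ (A' : C) (i : A ⟶ A') (p : A' ⟶ B), i ≫ p = f ∧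
          IsCardinalPresentable A' β ∧ IsPure κ p ∧ Mono p) := by
  have hN := presentableClosure_presentableMor (C := C) κ
  have hRe := underRetracts_transfiniteCompositions_presentableMor (C := C) κ
  have hrlp := presentableMor_rlp_eq C κ
  rw [hN, hRe, hrlp]
  refine ⟨rfl, injectives_presentableMor_iff, rfl, rfl,
    isWeakFactorizationSystem_top_isomorphisms, hasFunctorialFactorization_top_isomorphisms,
    fun A B f ↦ transfiniteCompositions_presentableMor κ f, fun A B f ↦ ⟨?_, fun S ↦ ?_⟩,
    fun A B f ↦ ⟨isPure_iff f, IsPure.mono⟩, fun A B f ↦ ⟨?_, fun L ↦ ?_⟩, ?_, ?_⟩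
  · exact nonempty_strictFactorization κ f
  · have hS := isIso_right_of_strictFactorization S
    exact ⟨transfiniteCompositions_presentableMor κ _, hS, hS⟩
  · exact nonempty_looseFactorization κ f
  · have hL := isPure_right_of_looseFactorization L
    exact ⟨transfiniteCompositions_presentableMor κ _, hL, hL.mono⟩
  · obtain ⟨γ, hγ, hκγ, h⟩ := exists_looseFactorization_bound C κ
    have : IsCardinalLocallyPresentable C γ := .of_le C hκγ
    refine ⟨γ, hγ, hκγ, fun A B f ↦ nonempty_looseFactorization γ f,
      fun β _ hβ hβ' A B f hA L ↦ ?_⟩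
    have hL := isPure_right_of_looseFactorization L
    exact ⟨h β hβ hβ' f hA L, hL, hL.of_le hκγ, hL.mono⟩
  · exact exists_pure_factorization C κ
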